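/- Let $n,m\ge 0$ be integers and let $\mathcal K_1,\dots,\mathcal K_m$ be arbitrary non-empty subsets of $[n]=\{1,\dots,n\}$ (so the interaction pattern $\epsilon$, defined by $\epsilon_{i,j}=1$ if $\mathcal K_i\cap\mathcal K_j=\emptyset$ and $\epsilon_{i,j}=0$ otherwise, is arbitrary). On a probability space, for each dimension $d$ let $G_1^{(d)},\dots,G_m^{(d)}$ be independent GUE random matrices with $G_\iota^{(d)}\in\bigotimes_{s\in\mathcal K_\iota}\mathbb M_d(\mathbb C)$; that is, with $N=d^{\#\mathcal K_\iota}$, the $N\times N$ matrix $G_\iota^{(d)}=(g_{ij})$ is almost surely Hermitian, its diagonal entries are real Gaussian with mean $0$ and variance $1/N$, the real and imaginary parts of its off-diagonal entries are Gaussian with mean $0$ and variance $1/(2N)$, and $\{\operatorname{Re} g_{ij}\}_{i\ge j}\cup\{\operatorname{Im} g_{ij}\}_{i>j}$ are independent. Nothing is assumed about the joint law for different $d$. Let $$H^{(d)}=\sum_{\iota=1}^m G_\iota^{(d)}\otimes\bigotimes_{s\notin\mathcal K_\iota}1_d\ \in\ \bigotimes_{s=1}^n\mathbb M_d(\mathbb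 C),$$ and let $\lambda_{\max}(H^{(d)})$ be its largest eigenvalue. Then, with probability one, $$\liminf_{d\to\infty}\lambda_{\max}(H^{(d)})\ \ge\ 2\sqrt m,$$ that is, almost surely, for every $\delta>0$ one has $\lambda_{\max}(H^{(d)})\ge 2\sqrt m-\delta$ for all sufficiently large $d$. -/

import Mathlib

open MeasureTheory ProbabilityTheory Filter
open scoped NNReal

namespace LocalGUE

/-- The real coordinates of a complex matrix `A` along an enumeration `e` of the index set:
`Re A i j` for `i ≥ j` (left summand) and `Im A i j` for `i > j` (right summand). -/
def realCoord {N : Type*} {k : ℕ} (e : N ≃ Fin k) (A : Matrix N N ℂ) :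
    {p : N × N // e p.2 ≤ e p.1} ⊕ {p : N × N // e p.2 < e p.1} → ℝ
  | .inl p => (A p.1.1 p.1.2).re
  | .inr p => (A p.1.1 p.1.2).im

/-- `G` is a (normalized) GUE random matrix with rows and columns indexed by the finite set `N`:
it is Hermitian; the diagonal entries are real Gaussian with mean `0` and variance `1 / #N`;
the real and imaginary parts of each off-diagonal entry are Gaussian with mean `0` and variance
`1 / (2 * #N)` (so `E |g i j|² = 1 / #N` for all `i, j`); and the real parts of the entries with
`i ≥ j` together with the imaginary parts of the entries with `i > j` are independent. The order
on `N` is that of an enumeration; replacing it by another one only changes signs of imaginary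
parts, so the condition does not depend on the enumeration. -/
structure IsGUE {Ω : Type*} [MeasurableSpace Ω] (P : Measure Ω) {N : Type*} [Fintype N]
    (G : Ω → Matrix N N ℂ) : Prop where
  isHermitian : ∀ᵐ ω ∂P, (G ω).IsHermitian
  diag_law : ∀ i : N,
    HasLaw (fun ω => (G ω i i).re) (gaussianReal 0 (1 / (Fintype.card N : ℝ≥0))) P
  re_law : ∀ i j : N, i ≠ j →
    HasLaw (fun ω => (G ω i j).re) (gaussianReal 0 (1 / (2 * (Fintype.card N : ℝ≥0)))) P
  im_law : ∀ i j : N, i ≠ j →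
    HasLaw (fun ω => (G ω i j).im) (gaussianReal 0 (1 / (2 * (Fintype.card N : ℝ≥0)))) P
  indep : ∃ e : N ≃ Fin (Fintype.card N),
    iIndepFun (fun c ω => realCoord e (G ω) c) P

/-- For a set `K` of sites and a matrix `A` in `⨂_{s ∈ K} M_d(ℂ)`, the operator
`A ⊗ ⨂_{s ∉ K} 1_d` in `⨂_{s ∈ [n]} M_d(ℂ)`, whose rows and columns are indexed by the
`n`-tuples with entries in `[d]`. -/
def localTerm {n d : ℕ} (K : Finset (Fin n)) (A : Matrix (K → Fin d) (K → Fin d) ℂ) :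
    Matrix (Fin n → Fin d) (Fin n → Fin d) ℂ :=
  Matrix.of fun i j =>
    A (fun s => i s) (fun s => j s) * ∏ s ∈ Kᶜ, (if i s = j s then (1 : ℂ) else 0)

/-- The total Hamiltonian `H = ∑ ι, H_ι` with local terms `H_ι = G_ι ⊗ ⨂_{s ∉ K_ι} 1_d`. -/
def hamiltonian {n m d : ℕ} (K : Fin m → Finset (Fin n))
    (G : ∀ ι : Fin m, Matrix (K ι → Fin d) (K ι → Fin d) ℂ) :
    Matrix (Fin n → Fin d) (Fin n → Fin d) ℂ :=
  ∑ ι, localTerm (K ι) (G ι)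

/-- The largest eigenvalue of a Hermitian matrix: the supremum of its (finite, real) spectrum. -/
noncomputable def lambdaMax {N : Type*} [Fintype N] [DecidableEq N] (A : Matrix N N ℂ) : ℝ :=
  sSup (spectrum ℝ A)

end LocalGUE

/-! Write `H = ∑ c, Z c • B c`, where `c` runs over the entries of all the local matrices, `Z c` is
a Gaussian entry and `B c` is a matrix unit tensored with an identity. Let `τ` be transposition of
entries. Then `Z (τ c)` is the conjugate of `Z c`, and it is the only entry with which `Z c` has a
nonzero covariance `𝔼 (Z c * Z c')`. The matrices `B c` have entries 0 and 1, so `tr H^p` is a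
polynomial in the `Z c` with nonnegative coefficients, and Gaussian integration by parts shows that
every such polynomial has nonnegative expectation. Pairings may therefore be discarded from Wick's
formula at will. `IsWick.catalan_le` keeps the noncrossing ones, which have full weight whatever the
overlaps of the `K ι`: the expected normalized moment of order `2k` is at least `m^k` times the
Catalan number, the moment of a semicircle law of variance `m` with edge `2√m`. Odd moments are at
least 0.

For the fluctuations, the Poincaré inequality `IsWick.covariance_le`, the Bessel bound
`IsModel.sum_normSq_trace_le` and the dimension-free bound `IsModel.expectation_trace_pow_le` give
variance `O(d⁻²)` for each normalized moment. This is summable, so by Chebyshev and Borel–Cantelli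
each moment is almost surely eventually above its semicircle value minus any tolerance, with no
assumption on the joint law in `d`.

Lower bounds on finitely many moments suffice for the edge (`exists_moments_imp_le_lambdaMax`). For
odd `L` and `R ≥ 0`, `(λ_max + R)^L` is at least the normalized trace of `(H + R)^L`, a combination
of moments with nonnegative coefficients. Semicircle moments match `(2√m)^j` up to a factor
polynomial in `L`, so this trace is at least about `(2√m + R)^L / (2 (L + 1)^2)`, and a large `L`
makes the polynomial factor harmless. -/

namespace LocalGUE

/-! ### Gaussian integration by parts on polynomials with nonnegative coefficients -/

open MvPolynomial in
/-- Induction on polynomials that passes from all partial derivatives of `F` to `X a * F`. -/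
theorem pderiv_induction {σ : Type*} {Q : MvPolynomial σ ℝ≥0 → Prop}
    (hC : ∀ r, Q (C r)) (hadd : ∀ F G, Q F → Q G → Q (F + G))
    (hX : ∀ a F, (∀ b, Q (pderiv b F)) → Q (X a * F)) (F : MvPolynomial σ ℝ≥0) : Q F := by
  classical
  have key : ∀ N : ℕ, ∀ s : σ →₀ ℕ, s.degree = N → ∀ r, Q (monomial s r) := by
    intro N
    induction N using Nat.strong_induction_on with
    | _ N ih =>
      intro s hs r
      by_cases h0 : s = 0
      · subst h0; exact hC r
      obtain ⟨a, ha⟩ : ∃ a, s a ≠ 0 := by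
        by_contra! h
        exact h0 (Finsupp.ext h)
      have hle : Finsupp.single a 1 ≤ s := by
        rw [Finsupp.single_le_iff]; omega
      have hs' : s = Finsupp.single a 1 + (s - Finsupp.single a 1) :=
        (add_tsub_cancel_of_le hle).symm
      have hdeg : (s - Finsupp.single a 1).degree + 1 = N := by
        have := congrArg Finsupp.degree hs'
        rw [map_add, Finsupp.degree_single] at this
        omega
      have hmon : monomial s r = X a * monomial (s - Finsupp.single a 1) r := by
        rw [X, monomial_mul, one_mul, ← hs']
      rw [hmon]
      refine hX a _ fun b => ?_
      rw [pderiv_monomial]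
      refine ih _ ?_ _ rfl _
      -- Subtraction is truncated, so the degree need not drop when `b` is absent from the monomial.
      -- Removing `a` has already lowered it below `N`, which is enough.
      have : (s - Finsupp.single a 1 - Finsupp.single b 1).degree ≤
          (s - Finsupp.single a 1).degree := Finsupp.degree_mono tsub_le_self
      omega
  induction F using MvPolynomial.induction_on' with
  | monomial s r => exact key _ s rfl r
  | add F G hF hG => exact hadd F G hF hG

/-- A linear functional on polynomials satisfying the Gaussian integration by parts formula, where
`X a` and `X (τ a)` are paired with covariance `v a`. -/
structure IsWick {σ : Type*} (τ : σ → σ) (v : σ → ℝ≥0)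
    (E : MvPolynomial σ ℝ≥0 →ₗ[ℝ≥0] ℝ) : Prop where
  map_one : E 1 = 1
  map_X_mul : ∀ a F, E (MvPolynomial.X a * F) = v a * E (MvPolynomial.pderiv (τ a) F)

namespace IsWick

open MvPolynomial

variable {σ : Type*} {τ : σ → σ} {v : σ → ℝ≥0} {E : MvPolynomial σ ℝ≥0 →ₗ[ℝ≥0] ℝ}

theorem map_C_mul (r : ℝ≥0) (F : MvPolynomial σ ℝ≥0) : E (C r * F) = r * E F := by
  rw [C_mul', map_smul, NNReal.smul_def, smul_eq_mul]

theorem map_C (h : IsWick τ v E) (r : ℝ≥0) : E (C r) = r := by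
  rw [← mul_one (C r), map_C_mul, h.map_one, mul_one]

/-- Integration by parts trades a factor `X a` for a derivative, which again has nonnegative
coefficients. This positivity is what allows unwanted Wick pairings to be dropped later. -/
theorem nonneg (h : IsWick τ v E) (F : MvPolynomial σ ℝ≥0) : 0 ≤ E F := by
  induction F using pderiv_induction with
  | hC r => rw [h.map_C]; positivity
  | hadd F G hF hG => rw [map_add]; positivity
  | hX a F ih => rw [h.map_X_mul]; exact mul_nonneg (v a).2 (ih _)

/-- Positive association: integrating `F * G` by parts along `F` produces, besides the pairings
inside `F`, pairings between `F` and `G`, and these are nonnegative. -/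
theorem mul_le (h : IsWick τ v E) (F G : MvPolynomial σ ℝ≥0) : E F * E G ≤ E (F * G) := by
  induction F using pderiv_induction with
  | hC r => rw [h.map_C, map_C_mul]
  | hadd F₁ F₂ h₁ h₂ => rw [add_mul, map_add, map_add, add_mul]; exact add_le_add h₁ h₂
  | hX a F ih =>
    rw [mul_assoc, h.map_X_mul, h.map_X_mul, pderiv_mul, map_add, mul_assoc]
    refine mul_le_mul_of_nonneg_left ?_ (v a).2
    have := ih (τ a)
    have := h.nonneg (F * pderiv (τ a) G)
    linarith

/-- The Gaussian Poincaré inequality, in covariance form, for polynomials with nonnegative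
coefficients. -/
theorem covariance_le [Fintype σ] (h : IsWick τ v E) (F G : MvPolynomial σ ℝ≥0) :
    E (F * G) ≤ E F * E G + ∑ c, v c * E (pderiv c F * pderiv (τ c) G) := by
  classical
  induction F using pderiv_induction with
  | hC r => simp [h.map_C, map_C_mul]
  | hadd F₁ F₂ h₁ h₂ =>
    simp only [add_mul, map_add, mul_add, Finset.sum_add_distrib]
    linarith
  | hX a F ih =>
    have e1 : ∀ c, E (pderiv c (X a * F) * pderiv (τ c) G) =
        E (pderiv c (X a) * F * pderiv (τ c) G) +
          v a * E (pderiv (τ a) (pderiv c F * pderiv (τ c) G)) := by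
      intro c
      rw [pderiv_mul, add_mul, map_add, mul_assoc (X a), h.map_X_mul]
    have e2 : ∑ c, (v c : ℝ) * E (pderiv c (X a) * F * pderiv (τ c) G) =
        v a * E (F * pderiv (τ a) G) := by
      rw [Finset.sum_eq_single a]
      · simp
      · intro b _ hb
        rw [pderiv_X_of_ne hb.symm]; simp
      · simp
    -- The only loss in the induction: the other term of the product rule, with two derivatives on
    -- `G`, is nonnegative and is dropped.
    have e3 : ∀ c, E (pderiv c (pderiv (τ a) F) * pderiv (τ c) G) ≤
        E (pderiv (τ a) (pderiv c F * pderiv (τ c) G)) := by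
      intro c
      rw [pderiv_mul, map_add]
      have hc : pderiv (τ a) (pderiv c F) = pderiv c (pderiv (τ a) F) := by
        ext s
        simp only [coeff_pderiv]
        rcases eq_or_ne (τ a) c with rfl | hne
        · rfl
        · simp [hne, hne.symm, add_right_comm, mul_right_comm]
      rw [hc]
      have := h.nonneg (pderiv c F * pderiv (τ a) (pderiv (τ c) G))
      linarith
    have e4 : ∑ c, (v c : ℝ) * E (pderiv c (X a * F) * pderiv (τ c) G) =
        v a * E (F * pderiv (τ a) G) +
          v a * ∑ c, v c * E (pderiv (τ a) (pderiv c F * pderiv (τ c) G)) := by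
      rw [← e2, Finset.mul_sum, ← Finset.sum_add_distrib]
      refine Finset.sum_congr rfl fun c _ => ?_
      rw [e1]; ring
    rw [e4, mul_assoc, h.map_X_mul, h.map_X_mul, pderiv_mul, map_add]
    have e5 := ih (τ a)
    have e6 : ∑ c, (v c : ℝ) * E (pderiv c (pderiv (τ a) F) * pderiv (τ c) G) ≤
        ∑ c, v c * E (pderiv (τ a) (pderiv c F * pderiv (τ c) G)) :=
      Finset.sum_le_sum fun c _ => mul_le_mul_of_nonneg_left (e3 c) (v c).2
    have e7 := mul_le_mul_of_nonneg_left (e5.trans (add_le_add_right e6 _)) (v a).2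
    simp only [NNReal.val_eq_coe] at e7
    linarith

end IsWick
-- Wick recursion for powers of a matrix of linear forms
section Formal

open MvPolynomial
open Finset.HasAntidiagonal (antidiagonal)

variable {σ I : Type*} [Fintype σ] [Fintype I] [DecidableEq I]

/-- The matrix `∑ c, X c • B c` whose entries are linear forms in the variables `X c`. -/
noncomputable def formalMatrix (B : σ → Matrix I I ℝ≥0) : Matrix I I (MvPolynomial σ ℝ≥0) :=
  Matrix.of fun x y => ∑ c, X c * C (B c x y)

/-- A matrix of scalars, seen as a matrix of constant polynomials. -/
noncomputable def constMatrix (σ : Type*) {I : Type*} (M : Matrix I I ℝ≥0) : Matrix I I (MvPolynomial σ ℝ≥0) := M.map C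

omit [Fintype σ] [DecidableEq I] in
theorem map_pderiv_mul (c : σ) (M N : Matrix I I (MvPolynomial σ ℝ≥0)) :
    (M * N).map (pderiv c) = M.map (pderiv c) * N + M * N.map (pderiv c) := by
  ext1 x y
  simp only [Matrix.mul_apply, Matrix.map_apply, Matrix.add_apply, map_sum, pderiv_mul,
    Finset.sum_add_distrib]

omit [Fintype σ] in
theorem map_pderiv_pow_succ (c : σ) (M : Matrix I I (MvPolynomial σ ℝ≥0)) (p : ℕ) :
    (M ^ (p + 1)).map (pderiv c) =
      ∑ ij ∈ antidiagonal p, M ^ ij.1 * M.map (pderiv c) * M ^ ij.2 := by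
  induction p with
  | zero => simp
  | succ p ih =>
    rw [pow_succ' M (p + 1), map_pderiv_mul, ih, Finset.Nat.sum_antidiagonal_succ, Finset.mul_sum]
    simp only [pow_zero, one_mul, pow_succ', mul_assoc]

omit [Fintype I] [DecidableEq I] in
theorem map_pderiv_formalMatrix (B : σ → Matrix I I ℝ≥0) (c : σ) :
    (formalMatrix B).map (pderiv c) = constMatrix σ (B c) := by
  classical
  ext1 x y
  simp only [formalMatrix, constMatrix, Matrix.map_apply, Matrix.of_apply, map_sum, pderiv_mul, pderiv_C,
    mul_zero, add_zero]
  rw [Finset.sum_eq_single c]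
  · simp
  · intro b _ hb
    rw [pderiv_X_of_ne hb, zero_mul]
  · simp

/-- By cyclicity of the trace, the `p + 1` positions of the differentiated factor contribute
equally. -/
theorem pderiv_trace_formalMatrix_pow (B : σ → Matrix I I ℝ≥0) (c : σ) (p : ℕ) :
    pderiv c (formalMatrix B ^ (p + 1)).trace =
      (p + 1) * (formalMatrix B ^ p * constMatrix σ (B c)).trace := by
  have h1 : pderiv c (formalMatrix B ^ (p + 1)).trace =
      ((formalMatrix B ^ (p + 1)).map (pderiv c)).trace := by
    simp [Matrix.trace, map_sum]
  rw [h1, map_pderiv_pow_succ, map_pderiv_formalMatrix, Matrix.trace_sum]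
  have h2 : ∀ ij ∈ antidiagonal p, (formalMatrix B ^ ij.1 * constMatrix σ (B c) *
      formalMatrix B ^ ij.2).trace = (formalMatrix B ^ p * constMatrix σ (B c)).trace := by
    intro ij hij
    rw [Matrix.trace_mul_comm, ← mul_assoc, ← pow_add, add_comm, Finset.HasAntidiagonal.mem_antidiagonal.1 hij]
  rw [Finset.sum_congr rfl h2]
  simp

namespace IsWick

variable {τ : σ → σ} {v : σ → ℝ≥0} {E : MvPolynomial σ ℝ≥0 →ₗ[ℝ≥0] ℝ}

omit [DecidableEq I] in
theorem formalMatrix_mul_apply (h : IsWick τ v E) (B : σ → Matrix I I ℝ≥0)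
    (W : Matrix I I (MvPolynomial σ ℝ≥0)) (x y : I) :
    E ((formalMatrix B * W) x y) =
      ∑ c, v c * E ((constMatrix σ (B c) * (W.map (pderiv (τ c)) : Matrix I I (MvPolynomial σ ℝ≥0))) x y) := by
  simp only [Matrix.mul_apply, formalMatrix, constMatrix, Matrix.of_apply, Finset.sum_mul, map_sum,
    Matrix.map_apply, Finset.mul_sum]
  rw [Finset.sum_comm]
  refine Finset.sum_congr rfl fun c _ => Finset.sum_congr rfl fun z _ => ?_
  rw [mul_assoc, h.map_X_mul, pderiv_C_mul]

/-- The first factor is paired with each of the others in turn; its partner cuts the remaining word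
into an inner part of length `ij.1` and an outer part of length `ij.2`. -/
theorem formalMatrix_pow_apply (h : IsWick τ v E) (B : σ → Matrix I I ℝ≥0) (p : ℕ) (x y : I) :
    E ((formalMatrix B ^ (p + 2)) x y) = ∑ c, v c * ∑ ij ∈ antidiagonal p,
      E ((constMatrix σ (B c) * formalMatrix B ^ ij.1 * constMatrix σ (B (τ c)) * formalMatrix B ^ ij.2) x y) := by
  rw [pow_succ', h.formalMatrix_mul_apply]
  refine Finset.sum_congr rfl fun c _ => ?_
  rw [map_pderiv_pow_succ, map_pderiv_formalMatrix, Finset.mul_sum, Matrix.sum_apply, map_sum]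
  simp only [mul_assoc]

theorem trace_formalMatrix_pow (h : IsWick τ v E) (B : σ → Matrix I I ℝ≥0) (p : ℕ) :
    E (formalMatrix B ^ (p + 2)).trace = ∑ c, v c * ∑ ij ∈ antidiagonal p,
      E (constMatrix σ (B c) * formalMatrix B ^ ij.1 * constMatrix σ (B (τ c)) * formalMatrix B ^ ij.2).trace := by
  simp only [Matrix.trace, map_sum, Matrix.diag_apply, h.formalMatrix_pow_apply]
  rw [Finset.sum_comm]
  refine Finset.sum_congr rfl fun c _ => ?_
  rw [← Finset.mul_sum, Finset.sum_comm]

/-- Even moments are bounded below by the number of noncrossing pairings. -/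
theorem catalan_le (h : IsWick τ v E) (B : σ → Matrix I I ℝ≥0) (m : ℕ)
    (hB : ∀ x, ∑ c, v c * ∑ y, B c x y * B (τ c) y x = m) (k : ℕ) (x : I) :
    (m : ℝ) ^ k * catalan k ≤ E ((formalMatrix B ^ (2 * k)) x x) := by
  induction k using Nat.strong_induction_on generalizing x with
  | _ k ih =>
    rcases k with _ | k
    · simp [h.map_one]
    -- Noncrossing pairings arise when the inner and outer words are paired separately. Among the
    -- matrix paths, keep those whose inner word is a loop at `y` and whose outer word is a loop at
    -- `x`; `mul_le` then separates the two expectations.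
    have hterm : ∀ c, ∀ ij ∈ antidiagonal k,
        (∑ y, (B c x y * B (τ c) y x : ℝ)) * (m ^ k * (catalan ij.1 * catalan ij.2)) ≤
        E ((constMatrix σ (B c) * formalMatrix B ^ (2 * ij.1) * constMatrix σ (B (τ c)) *
          formalMatrix B ^ (2 * ij.2)) x x) := by
      intro c ij hij
      have hk := Finset.HasAntidiagonal.mem_antidiagonal.1 hij
      have hexp : E ((constMatrix σ (B c) * formalMatrix B ^ (2 * ij.1) * constMatrix σ (B (τ c)) *
          formalMatrix B ^ (2 * ij.2)) x x) = ∑ w, ∑ u, ∑ y, (B c x y * B (τ c) u w : ℝ) *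
            E ((formalMatrix B ^ (2 * ij.1)) y u * (formalMatrix B ^ (2 * ij.2)) w x) := by
        simp only [Matrix.mul_apply, constMatrix, Matrix.map_apply, Finset.sum_mul, map_sum]
        refine Finset.sum_congr rfl fun w _ => Finset.sum_congr rfl fun u _ =>
          Finset.sum_congr rfl fun y _ => ?_
        rw [show C (B c x y) * (formalMatrix B ^ (2 * ij.1)) y u * C (B (τ c) u w) *
          (formalMatrix B ^ (2 * ij.2)) w x = C (B c x y) * (C (B (τ c) u w) *
          ((formalMatrix B ^ (2 * ij.1)) y u * (formalMatrix B ^ (2 * ij.2)) w x)) by ring,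
          map_C_mul, map_C_mul, mul_assoc]
      have hnn : ∀ w u y, 0 ≤ (B c x y * B (τ c) u w : ℝ) *
            E ((formalMatrix B ^ (2 * ij.1)) y u * (formalMatrix B ^ (2 * ij.2)) w x) :=
        fun w u y => mul_nonneg (by positivity) (h.nonneg _)
      rw [hexp, Finset.sum_mul]
      refine le_trans ?_ (Finset.single_le_sum (fun w _ => Finset.sum_nonneg fun u _ =>
        Finset.sum_nonneg fun y _ => hnn w u y) (Finset.mem_univ x))
      refine Finset.sum_le_sum fun y _ => ?_
      refine le_trans ?_ (Finset.single_le_sum (fun z _ => hnn x y z) (Finset.mem_univ y))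
      refine mul_le_mul_of_nonneg_left ?_ (by positivity)
      refine le_trans ?_ (h.mul_le _ _)
      have h1 := ih ij.1 (by omega) y
      have h2 := ih ij.2 (by omega) x
      calc (m : ℝ) ^ k * (catalan ij.1 * catalan ij.2)
          = (m ^ ij.1 * catalan ij.1) * (m ^ ij.2 * catalan ij.2) := by
            rw [← hk, pow_add]; ring
        _ ≤ _ := mul_le_mul h1 h2 (by positivity) (h.nonneg _)
    -- Splittings into two words of odd length are dropped; the remaining ones reproduce the Catalan
    -- recursion.
    have hsub : ∀ c, ∑ ij ∈ antidiagonal k, E ((constMatrix σ (B c) * formalMatrix B ^ (2 * ij.1) *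
          constMatrix σ (B (τ c)) * formalMatrix B ^ (2 * ij.2)) x x) ≤
        ∑ ij ∈ antidiagonal (2 * k), E ((constMatrix σ (B c) * formalMatrix B ^ ij.1 *
          constMatrix σ (B (τ c)) * formalMatrix B ^ ij.2) x x) := by
      intro c
      rw [← Finset.sum_image (s := antidiagonal k) (g := fun ij => (2 * ij.1, 2 * ij.2))
        (f := fun ij : ℕ × ℕ => E ((constMatrix σ (B c) * formalMatrix B ^ ij.1 *
          constMatrix σ (B (τ c)) * formalMatrix B ^ ij.2) x x))]
      · refine Finset.sum_le_sum_of_subset_of_nonneg ?_ fun _ _ _ => h.nonneg _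
        intro q hq
        obtain ⟨r, hr, rfl⟩ := Finset.mem_image.1 hq
        have := Finset.HasAntidiagonal.mem_antidiagonal.1 hr
        exact Finset.HasAntidiagonal.mem_antidiagonal.2 (by dsimp only; omega)
      · intro a _ b _ hab
        simp only [Prod.mk.injEq] at hab
        ext <;> omega
    rw [show 2 * (k + 1) = 2 * k + 2 by ring, h.formalMatrix_pow_apply, catalan_succ']
    have hm : ∑ c, (v c : ℝ) * ∑ y, (B c x y * B (τ c) y x : ℝ) = m := by exact_mod_cast hB x
    calc (m : ℝ) ^ (k + 1) * ((∑ ij ∈ antidiagonal k, catalan ij.1 * catalan ij.2 : ℕ) : ℝ)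
        = ∑ c, (v c : ℝ) * ∑ ij ∈ antidiagonal k,
          (∑ y, (B c x y * B (τ c) y x : ℝ)) * (m ^ k * (catalan ij.1 * catalan ij.2)) := by
          simp only [← Finset.mul_sum]
          simp only [← mul_assoc]
          rw [← Finset.sum_mul, ← Finset.sum_mul, hm]
          push_cast
          ring
      _ ≤ _ := Finset.sum_le_sum fun c _ => mul_le_mul_of_nonneg_left
          ((Finset.sum_le_sum (hterm c)).trans (hsub c)) (v c).2

end IsWick

end Formal

/-! ### Traces of Hermitian matrices, and passing from moments to the largest eigenvalue -/

section Hermitian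

open Matrix
open scoped ComplexOrder

variable {I : Type*} [Fintype I] [DecidableEq I]

theorem _root_.Matrix.IsHermitian.pow_eq_eigenvectorUnitary_mul {A : Matrix I I ℂ}
    (hA : A.IsHermitian) (p : ℕ) :
    A ^ p = (hA.eigenvectorUnitary : Matrix I I ℂ) *
      diagonal (fun k => ((hA.eigenvalues k : ℂ)) ^ p) *
      (star hA.eigenvectorUnitary : Matrix I I ℂ) := by
  conv_lhs => rw [hA.spectral_theorem]
  rw [← map_pow, Unitary.conjStarAlgAut_apply, diagonal_pow]
  rfl

theorem _root_.Matrix.IsHermitian.trace_pow_eq_sum_eigenvalues {A : Matrix I I ℂ}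
    (hA : A.IsHermitian) (p : ℕ) :
    (A ^ p).trace = ((∑ k, hA.eigenvalues k ^ p : ℝ) : ℂ) := by
  rw [hA.pow_eq_eigenvectorUnitary_mul, trace_mul_cycle]
  simp [trace_diagonal]

/-- The larger of `|x|` and `|y|` dominates. Only `a + b` has to be even, so odd splittings are
covered too. -/
theorem pow_mul_pow_le_add {x y : ℝ} {a b q : ℕ} (h : a + b = 2 * q) :
    x ^ a * y ^ b ≤ x ^ (2 * q) + y ^ (2 * q) := by
  have hle : x ^ a * y ^ b ≤ |x| ^ a * |y| ^ b := by
    rw [← abs_pow, ← abs_pow, ← abs_mul]; exact le_abs_self _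
  have hx : 0 ≤ x ^ (2 * q) := (even_two_mul q).pow_nonneg x
  have hy : 0 ≤ y ^ (2 * q) := (even_two_mul q).pow_nonneg y
  rw [← (even_two_mul q).pow_abs x] at *
  rw [← (even_two_mul q).pow_abs y] at *
  rcases le_total |x| |y| with hxy | hxy
  · have : |x| ^ a * |y| ^ b ≤ |y| ^ a * |y| ^ b := by gcongr
    rw [← pow_add, h] at this
    linarith
  · have : |x| ^ a * |y| ^ b ≤ |x| ^ a * |x| ^ b := by gcongr
    rw [← pow_add, h] at this
    linarith

theorem trace_mul_diagonal_mul_conjTranspose (W : Matrix I I ℂ) (f g : I → ℝ) :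
    (W * diagonal (fun k => (f k : ℂ)) * Wᴴ * diagonal (fun k => (g k : ℂ))).trace =
      ((∑ k, ∑ l, Complex.normSq (W k l) * (f l * g k) : ℝ) : ℂ) := by
  simp only [trace, diag_apply, mul_diagonal, Complex.ofReal_sum]
  refine Finset.sum_congr rfl fun k _ => ?_
  rw [mul_apply, Finset.sum_mul]
  refine Finset.sum_congr rfl fun l _ => ?_
  rw [mul_diagonal, conjTranspose_apply]
  push_cast
  rw [← Complex.mul_conj]
  simp only [RCLike.star_def]
  ring

/-- Unitary conjugation preserves the relation `h`; its diagonal entries in the new basis are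
weighted row sums of squared moduli. -/
theorem sum_smul_conj_mul_conjTranspose {σ : Type*} [Fintype σ] (v : σ → ℝ≥0)
    (W : σ → Matrix I I ℂ) (m : ℝ) (h : ∑ c, (v c : ℂ) • (W c * (W c)ᴴ) = (m : ℂ) • 1)
    {U : Matrix I I ℂ} (hU : Uᴴ * U = 1) (hU' : U * Uᴴ = 1) (k : I) :
    ∑ c, v c * ∑ l, Complex.normSq ((Uᴴ * W c * U) k l) = m := by
  have hV : ∀ c, (v c : ℂ) • ((Uᴴ * W c * U) * (Uᴴ * W c * U)ᴴ) =
      Uᴴ * ((v c : ℂ) • (W c * (W c)ᴴ)) * U := by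
    intro c
    rw [mul_smul_comm, smul_mul_assoc, conjTranspose_mul, conjTranspose_mul,
      conjTranspose_conjTranspose]
    congr 1
    calc Uᴴ * W c * U * (Uᴴ * ((W c)ᴴ * U)) = Uᴴ * W c * (U * Uᴴ) * ((W c)ᴴ * U) := by
          simp only [mul_assoc]
      _ = _ := by rw [hU', mul_one]; simp only [mul_assoc]
  have hsum : ∑ c, (v c : ℂ) • ((Uᴴ * W c * U) * (Uᴴ * W c * U)ᴴ) = (m : ℂ) • 1 := by
    rw [Finset.sum_congr rfl fun c _ => hV c, ← Finset.sum_mul, ← Finset.mul_sum, h,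
      mul_smul_comm, mul_one, smul_mul_assoc, hU]
  have h1 := congrFun (congrFun hsum k) k
  rw [Matrix.sum_apply] at h1
  have h2 : ∀ c, ((v c : ℂ) • ((Uᴴ * W c * U) * (Uᴴ * W c * U)ᴴ)) k k =
      ((v c * ∑ l, Complex.normSq ((Uᴴ * W c * U) k l) : ℝ) : ℂ) := by
    intro c
    generalize Uᴴ * W c * U = V
    simp [mul_apply, Complex.mul_conj]
  rw [Finset.sum_congr rfl fun c _ => h2 c] at h1
  rw [Matrix.smul_apply, one_apply_eq, smul_eq_mul, mul_one] at h1
  exact_mod_cast h1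

theorem trace_mul_conj_diagonal (U W : Matrix I I ℂ) (f g : I → ℂ) :
    (W * (U * diagonal f * Uᴴ) * Wᴴ * (U * diagonal g * Uᴴ)).trace =
      ((Uᴴ * W * U) * diagonal f * (Uᴴ * W * U)ᴴ * diagonal g).trace := by
  rw [conjTranspose_mul, conjTranspose_mul, conjTranspose_conjTranspose]
  calc _ = ((W * (U * diagonal f * Uᴴ) * Wᴴ * (U * diagonal g)) * Uᴴ).trace := by
        simp only [mul_assoc]
    _ = _ := by rw [trace_mul_comm]; simp only [mul_assoc]

/-- If `∑ c, v c • W c * (W c)ᴴ = m = ∑ c, v c • (W c)ᴴ * W c`, then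
`∑ c, v c * tr (W c * A ^ a * (W c)ᴴ * A ^ b)` is controlled by `tr (A ^ (a + b))`. -/
theorem sum_trace_mul_pow_le {σ : Type*} [Fintype σ] (v : σ → ℝ≥0) (W : σ → Matrix I I ℂ) (m : ℝ)
    (hl : ∑ c, (v c : ℂ) • (W c * (W c)ᴴ) = (m : ℂ) • 1)
    (hr : ∑ c, (v c : ℂ) • ((W c)ᴴ * W c) = (m : ℂ) • 1)
    {A : Matrix I I ℂ} (hA : A.IsHermitian) {a b q : ℕ} (h : a + b = 2 * q) :
    ∑ c, v c * (W c * A ^ a * (W c)ᴴ * A ^ b).trace.re ≤ 2 * m * (A ^ (2 * q)).trace.re := by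
  obtain ⟨U, ev, hU, hU', hpow⟩ : ∃ (U : Matrix I I ℂ) (ev : I → ℝ), Uᴴ * U = 1 ∧ U * Uᴴ = 1 ∧
      ∀ p, A ^ p = U * diagonal (fun k => ((ev k ^ p : ℝ) : ℂ)) * Uᴴ := by
    refine ⟨hA.eigenvectorUnitary.1, hA.eigenvalues, Unitary.coe_star_mul_self _,
      Unitary.coe_mul_star_self _, fun p => ?_⟩
    simpa [star_eq_conjTranspose] using hA.pow_eq_eigenvectorUnitary_mul p
  have hrow := sum_smul_conj_mul_conjTranspose v W m hl hU hU'
  have hcol : ∀ l, ∑ c, v c * ∑ k, Complex.normSq ((Uᴴ * W c * U) k l) = m := by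
    intro l
    rw [← sum_smul_conj_mul_conjTranspose v (fun c => (W c)ᴴ) m
      (by simpa only [conjTranspose_conjTranspose] using hr) hU hU' l]
    refine Finset.sum_congr rfl fun c _ => ?_
    congr 1
    refine Finset.sum_congr rfl fun k _ => ?_
    rw [show Uᴴ * (W c)ᴴ * U = (Uᴴ * W c * U)ᴴ by
      rw [conjTranspose_mul, conjTranspose_mul, conjTranspose_conjTranspose, mul_assoc],
      conjTranspose_apply, RCLike.star_def, Complex.normSq_conj]
  -- In the eigenbasis of `A` the trace is a sum of eigenvalue products with nonnegative weights, so
  -- the products can be bounded pointwise by pure powers, whose weights are the row and column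
  -- sums.
  have htr : ∀ c, (W c * A ^ a * (W c)ᴴ * A ^ b).trace.re =
      ∑ k, ∑ l, Complex.normSq ((Uᴴ * W c * U) k l) * (ev l ^ a * ev k ^ b) := by
    intro c
    rw [hpow, hpow, trace_mul_conj_diagonal, trace_mul_diagonal_mul_conjTranspose,
      Complex.ofReal_re]
  have hA' : (A ^ (2 * q)).trace.re = ∑ k, ev k ^ (2 * q) := by
    rw [hpow, trace_mul_comm, ← mul_assoc, hU, one_mul, trace_diagonal, ← Complex.ofReal_sum,
      Complex.ofReal_re]
  rw [hA']
  simp only [htr]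
  calc ∑ c, (v c : ℝ) * ∑ k, ∑ l, Complex.normSq ((Uᴴ * W c * U) k l) * (ev l ^ a * ev k ^ b)
      ≤ ∑ c, (v c : ℝ) * ∑ k, ∑ l, Complex.normSq ((Uᴴ * W c * U) k l) *
          (ev l ^ (2 * q) + ev k ^ (2 * q)) := by
        gcongr with c _ k _ l _
        · exact Complex.normSq_nonneg _
        · exact pow_mul_pow_le_add h
    _ = ∑ l, (∑ c, v c * ∑ k, Complex.normSq ((Uᴴ * W c * U) k l)) * ev l ^ (2 * q) +
        ∑ k, (∑ c, v c * ∑ l, Complex.normSq ((Uᴴ * W c * U) k l)) * ev k ^ (2 * q) := by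
        simp only [mul_add, Finset.sum_add_distrib, Finset.sum_mul, Finset.mul_sum]
        congr 1
        · rw [Finset.sum_comm (s := Finset.univ (α := I)) (t := Finset.univ (α := σ))]
          refine Finset.sum_congr rfl fun c _ => ?_
          rw [Finset.sum_comm]
          simp only [mul_assoc]
        · rw [Finset.sum_comm (s := Finset.univ (α := I)) (t := Finset.univ (α := σ))]
          simp only [mul_assoc]
    _ = _ := by
        simp only [hrow, hcol, ← Finset.mul_sum]
        ring

/-- The moments of the semicircle distribution of variance `m`. -/
noncomputable def semicircleMoment (m j : ℕ) : ℝ :=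
  if Even j then (m : ℝ) ^ (j / 2) * catalan (j / 2) else 0

/-- For `j = 2k` with `k > 0` this rests on `4^k ≤ 2k * centralBinom k = 2k (k + 1) * catalan k` and
`2k ≤ L`; for odd `j` both sides vanish. Adding the point `-2√m` removes odd powers, for which the
semicircle gives no lower bound. -/
theorem pow_add_neg_pow_le_semicircleMoment (m : ℕ) {j L : ℕ} (hj : j ≤ L) :
    (2 * √m) ^ j + (-(2 * √m)) ^ j ≤ 2 * (L + 1 : ℝ) ^ 2 * semicircleMoment m j := by
  rcases Nat.even_or_odd j with he | ho
  · rw [he.neg_pow, semicircleMoment, if_pos he]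
    obtain ⟨k, rfl⟩ := he
    simp only [← two_mul k]
    rw [Nat.mul_div_cancel_left _ two_pos, pow_mul (2 * √(m : ℝ)), mul_pow,
      Real.sq_sqrt (Nat.cast_nonneg m), mul_pow]
    have hc : 4 ^ k ≤ (L + 1) ^ 2 * catalan k := by
      rcases Nat.eq_zero_or_pos k with rfl | hk
      · simpa using Nat.one_le_pow 2 (L + 1) (by omega)
      have h1 := Nat.four_pow_le_two_mul_self_mul_centralBinom k hk
      rw [← succ_mul_catalan_eq_centralBinom] at h1
      refine h1.trans ?_
      rw [← mul_assoc]
      refine Nat.mul_le_mul_right _ ?_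
      rw [sq]
      exact Nat.mul_le_mul (by omega) (by omega)
    have hc' : (4 : ℝ) ^ k ≤ (L + 1) ^ 2 * catalan k := by exact_mod_cast hc
    have := mul_le_mul_of_nonneg_right hc' (pow_nonneg (Nat.cast_nonneg (α := ℝ) m) k)
    norm_num
    linarith
  · rw [ho.neg_pow, semicircleMoment, if_neg (Nat.not_even_iff_odd.2 ho)]
    simp

theorem exists_odd_pow_lt {x y : ℝ} (hx : 0 ≤ x) (hxy : x < y) :
    ∃ L : ℕ, Odd L ∧ x ^ L < y ^ L / (2 * (L + 1 : ℝ) ^ 2) := by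
  have hy : 0 < y := hx.trans_lt hxy
  have ht := tendsto_pow_const_mul_const_pow_of_abs_lt_one 2 (r := x / y)
    (by rw [abs_of_nonneg (by positivity)]; exact (div_lt_one hy).2 hxy)
  -- The threshold `1 / 8` comes from `2 (L + 1)^2 ≤ 8 L^2` for `L ≥ 1`.
  have hev := (ht.eventually (gt_mem_nhds (show (0 : ℝ) < 1 / 8 by norm_num))).and
    (eventually_ge_atTop 1)
  obtain ⟨N, hN⟩ := eventually_atTop.1 hev
  obtain ⟨h1, h2⟩ := hN (2 * N + 1) (by omega)
  refine ⟨2 * N + 1, odd_two_mul_add_one N, ?_⟩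
  set L := 2 * N + 1
  have hL : (1 : ℝ) ≤ L := by exact_mod_cast h2
  rw [div_pow, ← mul_div_assoc, div_lt_iff₀ (by positivity)] at h1
  rw [lt_div_iff₀ (by positivity)]
  have h3 : 2 * (L + 1 : ℝ) ^ 2 ≤ 8 * (L : ℝ) ^ 2 := by nlinarith
  have := mul_le_mul_of_nonneg_left h3 (pow_nonneg hx L)
  linarith

theorem eigenvalues_le_lambdaMax {A : Matrix I I ℂ} (hA : A.IsHermitian) (k : I) :
    hA.eigenvalues k ≤ lambdaMax A :=
  le_csSup (finite_real_spectrum).bddAbove (hA.eigenvalues_mem_spectrum_real k)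

/-- The left side is the normalized trace of `(A + R)^L`. An odd power is monotone on the whole
line, so no lower bound on the spectrum is needed. -/
theorem sum_choose_trace_pow_le {A : Matrix I I ℂ} (hA : A.IsHermitian) {a : ℝ}
    (ha : lambdaMax A ≤ a) (R : ℝ) {L : ℕ} (hL : Odd L) [Nonempty I] :
    ∑ j ∈ Finset.range (L + 1), R ^ (L - j) * L.choose j *
      ((A ^ j).trace.re / Fintype.card I) ≤ (a + R) ^ L := by
  have hcard : (0 : ℝ) < Fintype.card I := by exact_mod_cast Fintype.card_pos
  have h1 : ∑ j ∈ Finset.range (L + 1), R ^ (L - j) * L.choose j *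
      ((A ^ j).trace.re / Fintype.card I) =
      (∑ k, (hA.eigenvalues k + R) ^ L) / Fintype.card I := by
    simp only [hA.trace_pow_eq_sum_eigenvalues, Complex.ofReal_re, add_pow]
    rw [Finset.sum_comm, Finset.sum_div]
    refine Finset.sum_congr rfl fun j _ => ?_
    rw [← mul_div_assoc, Finset.mul_sum]
    congr 1
    refine Finset.sum_congr rfl fun k _ => ?_
    ring
  rw [h1, div_le_iff₀ hcard]
  calc ∑ k, (hA.eigenvalues k + R) ^ L ≤ ∑ _k : I, (a + R) ^ L :=
        Finset.sum_le_sum fun k _ => hL.strictMono_pow.monotone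
          (by linarith [eigenvalues_le_lambdaMax hA k])
    _ = _ := by rw [Finset.sum_const, nsmul_eq_mul, mul_comm]; rfl

/-- If finitely many normalized moments of a Hermitian matrix almost dominate those of the
semicircle distribution of variance `m`, then its largest eigenvalue is almost at least `2 √m`. -/
theorem exists_moments_imp_le_lambdaMax (m : ℕ) {δ : ℝ} (hδ : 0 < δ) :
    ∃ L : ℕ, ∃ η : ℝ, 0 < η ∧ ∀ (I : Type) [Fintype I] [DecidableEq I] [Nonempty I]
      (A : Matrix I I ℂ), A.IsHermitian →
      (∀ j ≤ L, semicircleMoment m j - η ≤ (A ^ j).trace.re / Fintype.card I) →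
      2 * √m - δ ≤ lambdaMax A := by
  set s : ℝ := 2 * √m with hs
  have hs0 : 0 ≤ s := by positivity
  -- This shift makes `-s + R` nonnegative, so its power can be discarded, and capping `δ` at 1
  -- keeps `a + R` nonnegative.
  set R := s + 1 with hR
  set a := s - min δ 1 with ha
  have hδ' : 0 < min δ 1 := lt_min hδ one_pos
  have hδ1 : min δ 1 ≤ 1 := min_le_right _ _
  obtain ⟨L, hL, hlt⟩ := exists_odd_pow_lt (x := a + R) (y := s + R) (by linarith) (by linarith)
  -- An error `η` in every moment costs `η * (1 + R)^L` in the binomial sum; this choice spends half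
  -- of the available gap.
  refine ⟨L, ((s + R) ^ L / (2 * (L + 1 : ℝ) ^ 2) - (a + R) ^ L) / (2 * (1 + R) ^ L),
    by have : 0 < 1 + R := by linarith
       exact div_pos (by linarith) (by positivity), ?_⟩
  intro I _ _ _ A hA hmom
  set η := ((s + R) ^ L / (2 * (L + 1 : ℝ) ^ 2) - (a + R) ^ L) / (2 * (1 + R) ^ L) with hη
  by_contra! hcon
  have h1 := sum_choose_trace_pow_le hA (a := a)
    (by have := min_le_left δ 1; linarith) R hL
  have hR0 : 0 ≤ R := by linarith
  have h2 : ∑ j ∈ Finset.range (L + 1), R ^ (L - j) * L.choose j * (semicircleMoment m j - η) ≤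
      (a + R) ^ L := by
    refine le_trans (Finset.sum_le_sum fun j hj => ?_) h1
    exact mul_le_mul_of_nonneg_left (hmom j (by simpa [Nat.lt_succ_iff] using hj)) (by positivity)
  have h3 : η * (1 + R) ^ L = ∑ j ∈ Finset.range (L + 1), R ^ (L - j) * L.choose j * η := by
    rw [add_pow, Finset.mul_sum]
    refine Finset.sum_congr rfl fun j _ => ?_
    rw [one_pow]; ring
  have h4 : (s + R) ^ L + (-s + R) ^ L ≤ 2 * (L + 1 : ℝ) ^ 2 *
      ∑ j ∈ Finset.range (L + 1), R ^ (L - j) * L.choose j * semicircleMoment m j := by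
    rw [add_pow, add_pow, ← Finset.sum_add_distrib, Finset.mul_sum]
    refine Finset.sum_le_sum fun j hj => ?_
    have := mul_le_mul_of_nonneg_left (pow_add_neg_pow_le_semicircleMoment m
      (j := j) (L := L) (by simpa [Nat.lt_succ_iff] using hj))
      (show 0 ≤ R ^ (L - j) * (L.choose j : ℝ) by positivity)
    linarith
  have h5 : (0 : ℝ) ≤ (-s + R) ^ L := pow_nonneg (by linarith) _
  have h6 : (s + R) ^ L / (2 * (L + 1 : ℝ) ^ 2) ≤
      ∑ j ∈ Finset.range (L + 1), R ^ (L - j) * L.choose j * semicircleMoment m j := by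
    rw [div_le_iff₀' (by positivity)]
    linarith
  simp only [mul_sub, Finset.sum_sub_distrib] at h2
  rw [← h3] at h2
  have h7 : η * (1 + R) ^ L = ((s + R) ^ L / (2 * (L + 1 : ℝ) ^ 2) - (a + R) ^ L) / 2 := by
    have : (1 + R) ^ L ≠ 0 := by positivity
    rw [hη]; field_simp
  linarith

end Hermitian

/-! ### Integration by parts for Gaussians and their linear combinations -/

section Gaussian

theorem integrable_pow_mul_gaussianPDFReal {v : ℝ≥0} (hv : v ≠ 0) (a : ℕ) :
    Integrable fun x => x ^ a * gaussianPDFReal 0 v x := by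
  have hv' : (0 : ℝ) < v := by positivity
  have h := (integrable_rpow_mul_exp_neg_mul_sq (b := (2 * (v : ℝ))⁻¹) (by positivity)
    (s := a) (by have : (0 : ℝ) ≤ a := by positivity
                 linarith)).const_mul (√(2 * Real.pi * v))⁻¹
  refine h.congr (Eventually.of_forall fun x => ?_)
  simp only [gaussianPDFReal, Real.rpow_natCast, sub_zero]
  rw [show -x ^ 2 / (2 * (v : ℝ)) = -(2 * (v : ℝ))⁻¹ * x ^ 2 by field_simp]
  ring

theorem hasDerivAt_gaussianPDFReal {v : ℝ≥0} (hv : v ≠ 0) (x : ℝ) :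
    HasDerivAt (gaussianPDFReal 0 v) (-(x / v) * gaussianPDFReal 0 v x) x := by
  have hv' : (v : ℝ) ≠ 0 := by exact_mod_cast hv
  have h1 : HasDerivAt (fun y : ℝ => -(y - 0) ^ 2 / (2 * (v : ℝ))) (-(x / v)) x := by
    have := (((hasDerivAt_id x).sub_const 0).pow 2).neg.div_const (2 * (v : ℝ))
    refine this.congr_deriv ?_
    simp
    field_simp
  refine (h1.exp.const_mul (√(2 * Real.pi * v))⁻¹).congr_deriv ?_
  simp only [gaussianPDFReal]
  ring

/-- Integration by parts for the moments of a centered Gaussian. -/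
theorem integral_pow_succ_gaussianReal {v : ℝ≥0} (hv : v ≠ 0) (a : ℕ) :
    ∫ x, x ^ (a + 1) ∂(gaussianReal 0 v) = v * (a * ∫ x, x ^ (a - 1) ∂(gaussianReal 0 v)) := by
  have hv' : (v : ℝ) ≠ 0 := by exact_mod_cast hv
  have hint := integrable_pow_mul_gaussianPDFReal hv
  have hd : ∀ x : ℝ, HasDerivAt (fun x => x ^ a * gaussianPDFReal 0 v x)
      (a * (x ^ (a - 1) * gaussianPDFReal 0 v x) -
        (v : ℝ)⁻¹ * (x ^ (a + 1) * gaussianPDFReal 0 v x)) x := by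
    intro x
    refine ((hasDerivAt_pow a x).mul (hasDerivAt_gaussianPDFReal hv x)).congr_deriv ?_
    field_simp
    ring
  -- The derivative of `x^a` times the density has integral zero. For `a = 0` the truncated exponent
  -- `a - 1` is harmless because its coefficient is `a`.
  have h0 := integral_eq_zero_of_hasDerivAt_of_integrable hd
    (((hint (a - 1)).const_mul _).sub ((hint (a + 1)).const_mul _)) (hint a)
  rw [integral_sub ((hint (a - 1)).const_mul _) ((hint (a + 1)).const_mul _),
    integral_const_mul, integral_const_mul] at h0
  rw [integral_gaussianReal_eq_integral_smul hv, integral_gaussianReal_eq_integral_smul hv]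
  simp only [smul_eq_mul, mul_comm (gaussianPDFReal 0 v _)]
  field_simp at h0
  linarith

variable {Ω : Type*} [MeasurableSpace Ω] {P : Measure Ω} [IsProbabilityMeasure P]

/-- All absolute moments of `f` are finite. -/
def HasMoments (P : Measure Ω) (f : Ω → ℂ) : Prop := ∀ p : ℝ≥0, MemLp f p P

namespace HasMoments

variable {f g : Ω → ℂ}

theorem const (c : ℂ) : HasMoments P fun _ => c := fun _ => memLp_const c

omit [IsProbabilityMeasure P] in
theorem add (hf : HasMoments P f) (hg : HasMoments P g) : HasMoments P fun ω => f ω + g ω :=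
  fun p => (hf p).add (hg p)

omit [IsProbabilityMeasure P] in
theorem mul (hf : HasMoments P f) (hg : HasMoments P g) : HasMoments P fun ω => f ω * g ω := by
  intro p
  have : ENNReal.HolderTriple ((2 * p : ℝ≥0) : ENNReal) ((2 * p : ℝ≥0) : ENNReal) (p : ENNReal) := by
    constructor
    rw [ENNReal.coe_mul, ENNReal.coe_ofNat, ENNReal.mul_inv (by simp) (by simp), ← add_mul,
      ENNReal.inv_two_add_inv_two, one_mul]
  exact (hg (2 * p)).mul (hf (2 * p))

omit [IsProbabilityMeasure P] in
theorem congr (hf : HasMoments P f) (h : f =ᵐ[P] g) : HasMoments P g :=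
  fun p => (memLp_congr_ae h).1 (hf p)

omit [IsProbabilityMeasure P] in
theorem integrable (hf : HasMoments P f) : Integrable f P := by
  have := hf 1
  rwa [ENNReal.coe_one, memLp_one_iff_integrable] at this

theorem aeval {σ R : Type*} [CommSemiring R] [Algebra R ℂ] {Z : σ → Ω → ℂ}
    (hZ : ∀ c, HasMoments P (Z c)) (F : MvPolynomial σ R) :
    HasMoments P fun ω => MvPolynomial.aeval (fun c => Z c ω) F := by
  induction F using MvPolynomial.induction_on with
  | C r => simpa using const (P := P) (algebraMap R ℂ r)
  | add F G hF hG => simpa using hF.add hG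
  | mul_X F c hF => simpa using hF.mul (hZ c)

end HasMoments

open MvPolynomial in
/-- Gaussian integration by parts for polynomials in independent centered Gaussians. -/
theorem integral_mul_eval_eq_integral_pderiv {κ : Type*} [Fintype κ] {ξ : κ → Ω → ℝ} {u : κ → ℝ≥0}
    (hu : ∀ k, u k ≠ 0) (hξ : ∀ k, HasLaw (ξ k) (gaussianReal 0 (u k)) P)
    (hprod : ∀ α : κ → ℕ, ∫ ω, ∏ k, ξ k ω ^ α k ∂P = ∏ k, ∫ ω, ξ k ω ^ α k ∂P)
    (hmom : ∀ k, HasMoments P fun ω => (ξ k ω : ℂ)) (k : κ) (F : MvPolynomial κ ℂ) :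
    ∫ ω, (ξ k ω : ℂ) * aeval (fun k => (ξ k ω : ℂ)) F ∂P =
      u k * ∫ ω, aeval (fun k => (ξ k ω : ℂ)) (pderiv k F) ∂P := by
  classical
  have hlaw : ∀ k a, ∫ ω, ξ k ω ^ a ∂P = ∫ x, x ^ a ∂(gaussianReal 0 (u k)) := by
    intro k a
    rw [← (hξ k).map_eq, integral_map (hξ k).aemeasurable (by fun_prop)]
  have hmono : ∀ (s : κ →₀ ℕ) (r : ℂ), ∫ ω, aeval (fun k => (ξ k ω : ℂ)) (monomial s r) ∂P =
      r * ((∏ k, ∫ ω, ξ k ω ^ s k ∂P : ℝ) : ℂ) := by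
    intro s r
    rw [← hprod, ← integral_complex_ofReal, ← integral_const_mul]
    congr 1
    ext ω
    rw [aeval_monomial, Finsupp.prod_fintype _ _ (by simp)]
    simp
  induction F using MvPolynomial.induction_on' with
  | monomial s r =>
    have h1 : ∀ ω, (ξ k ω : ℂ) * aeval (fun k => (ξ k ω : ℂ)) (monomial s r) =
        aeval (fun k => (ξ k ω : ℂ)) (monomial (Finsupp.single k 1 + s) r) := by
      intro ω
      rw [show (monomial (Finsupp.single k 1 + s) r : MvPolynomial κ ℂ) = X k * monomial s r by
        rw [X, monomial_mul, one_mul], map_mul, aeval_X]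
    simp only [h1]
    rw [hmono, pderiv_monomial, hmono,
      ← Finset.mul_prod_erase Finset.univ
        (fun j => ∫ ω, ξ j ω ^ (Finsupp.single k 1 + s : κ →₀ ℕ) j ∂P) (Finset.mem_univ k),
      ← Finset.mul_prod_erase Finset.univ
        (fun j => ∫ ω, ξ j ω ^ (s - Finsupp.single k 1 : κ →₀ ℕ) j ∂P) (Finset.mem_univ k)]
    have h2 : ∏ j ∈ Finset.univ.erase k, ∫ ω, ξ j ω ^ (Finsupp.single k 1 + s : κ →₀ ℕ) j ∂P =
        ∏ j ∈ Finset.univ.erase k, ∫ ω, ξ j ω ^ (s - Finsupp.single k 1 : κ →₀ ℕ) j ∂P := by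
      refine Finset.prod_congr rfl fun j hj => ?_
      have hj : k ≠ j := (Finset.ne_of_mem_erase hj).symm
      simp [hj]
    rw [h2]
    simp only [Finsupp.add_apply, Finsupp.tsub_apply, Finsupp.single_eq_same]
    rw [add_comm 1, hlaw, hlaw, integral_pow_succ_gaussianReal (hu k)]
    push_cast
    ring
  | add F G hF hG =>
    simp only [map_add, mul_add]
    rw [integral_add ((hmom k).mul (HasMoments.aeval hmom F)).integrable
      ((hmom k).mul (HasMoments.aeval hmom G)).integrable, hF, hG,
      integral_add (HasMoments.aeval hmom _).integrable (HasMoments.aeval hmom _).integrable,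
      mul_add]

open MvPolynomial in
/-- The substitution `X c ↦ ∑ k, M c k * X k`. -/
noncomputable def linearSubst {σ κ : Type*} [Fintype κ] (M : σ → κ → ℂ) :
    MvPolynomial σ ℝ≥0 →ₐ[ℝ≥0] MvPolynomial κ ℂ :=
  aeval (fun c => ∑ k, C (M c k) * X k)

open MvPolynomial in
theorem linearSubst_X {σ κ : Type*} [Fintype κ] (M : σ → κ → ℂ) (c : σ) :
    linearSubst M (X c) = ∑ k, C (M c k) * X k := aeval_X _ _

open MvPolynomial in
-- The chain rule, which carries integration by parts from the real coordinates over to the complex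
-- family. Coefficients become complex here because the imaginary unit enters the substitution.
theorem pderiv_linearSubst {σ κ : Type*} [Fintype σ] [Fintype κ] (M : σ → κ → ℂ) (k : κ)
    (F : MvPolynomial σ ℝ≥0) :
    pderiv k (linearSubst M F) = ∑ c, C (M c k) * linearSubst M (pderiv c F) := by
  classical
  induction F using MvPolynomial.induction_on with
  | C r =>
    simp only [algHom_C, pderiv_C, map_zero, mul_zero, Finset.sum_const_zero]
    rw [IsScalarTower.algebraMap_apply ℝ≥0 ℂ (MvPolynomial κ ℂ) r]
    exact pderiv_C
  | add F G hF hG => simp only [map_add, hF, hG, mul_add, Finset.sum_add_distrib]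
  | mul_X F c hF =>
    have h1 : pderiv k (∑ k, C (M c k) * X k : MvPolynomial κ ℂ) = C (M c k) := by
      rw [map_sum, Finset.sum_eq_single k]
      · simp
      · intro j _ hj
        simp [pderiv_X_of_ne hj]
      · simp
    rw [map_mul, pderiv_mul, hF, linearSubst_X, h1]
    simp only [pderiv_mul, map_add, map_mul, linearSubst_X, mul_add, Finset.sum_add_distrib,
      Finset.sum_mul, mul_assoc]
    congr 1
    rw [Finset.sum_eq_single c]
    · simp [mul_comm]
    · intro b _ hb
      simp [pderiv_X_of_ne hb.symm]
    · simp

/-- The functional `F ↦ 𝔼 Re F(Z)` on polynomials with nonnegative coefficients. -/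
noncomputable def expectation {σ : Type*} (P : Measure Ω) [IsProbabilityMeasure P] {Z : σ → Ω → ℂ}
    (hZ : ∀ c, HasMoments P (Z c)) : MvPolynomial σ ℝ≥0 →ₗ[ℝ≥0] ℝ where
  toFun F := (∫ ω, MvPolynomial.aeval (fun c => Z c ω) F ∂P).re
  map_add' F G := by
    simp only [map_add]
    rw [integral_add (HasMoments.aeval hZ F).integrable (HasMoments.aeval hZ G).integrable,
      Complex.add_re]
  map_smul' r F := by
    simp only [map_smul, RingHom.id_apply, NNReal.smul_def, Complex.real_smul, integral_const_mul,
      Complex.re_ofReal_mul, smul_eq_mul]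

open MvPolynomial in
/-- Linear combinations of independent Gaussians satisfy the integration by parts formula. -/
theorem isWick_expectation {σ κ : Type*} [Fintype σ] [Fintype κ] {τ : σ → σ} {v : σ → ℝ≥0}
    {ξ : κ → Ω → ℝ} {u : κ → ℝ≥0} (hu : ∀ k, u k ≠ 0)
    (hξ : ∀ k, HasLaw (ξ k) (gaussianReal 0 (u k)) P)
    (hprod : ∀ α : κ → ℕ, ∫ ω, ∏ k, ξ k ω ^ α k ∂P = ∏ k, ∫ ω, ξ k ω ^ α k ∂P)
    (hmom : ∀ k, HasMoments P fun ω => (ξ k ω : ℂ)) (M : σ → κ → ℂ)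
    (hcov : ∀ c c', ∑ k, M c k * (u k * M c' k) = Set.indicator {τ c} (fun _ => (v c : ℂ)) c')
    {Z : σ → Ω → ℂ} (hZ : ∀ c, HasMoments P (Z c))
    (hZM : ∀ c, Z c =ᵐ[P] fun ω => ∑ k, M c k * ξ k ω) : IsWick τ v (expectation P hZ) := by
  classical
  refine ⟨by simp [expectation], fun a F => ?_⟩
  have hall : ∀ᵐ ω ∂P, ∀ c, Z c ω = ∑ k, M c k * ξ k ω := ae_all_iff.2 hZM
  set L := linearSubst M with hL
  have heval : ∀ G, ∀ᵐ ω ∂P, aeval (fun c => Z c ω) G = aeval (fun k => (ξ k ω : ℂ)) (L G) := by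
    intro G
    filter_upwards [hall] with ω hω
    have : (aeval (fun c => Z c ω) : MvPolynomial σ ℝ≥0 →ₐ[ℝ≥0] ℂ) =
        ((aeval (fun k => (ξ k ω : ℂ)) : MvPolynomial κ ℂ →ₐ[ℂ] ℂ).restrictScalars ℝ≥0).comp L := by
      ext c
      simp [hL, linearSubst_X, hω c]
    rw [this]
    rfl
  have hstein := integral_mul_eval_eq_integral_pderiv hu hξ hprod hmom
  have hint : ∀ G : MvPolynomial κ ℂ, Integrable (fun ω => aeval (fun k => (ξ k ω : ℂ)) G) P :=
    fun G => (HasMoments.aeval hmom G).integrable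
  have key : ∫ ω, aeval (fun c => Z c ω) (X a * F) ∂P =
      v a * ∫ ω, aeval (fun c => Z c ω) (pderiv (τ a) F) ∂P := by
    calc ∫ ω, aeval (fun c => Z c ω) (X a * F) ∂P
        = ∫ ω, ∑ k, M a k * ((ξ k ω : ℂ) * aeval (fun k => (ξ k ω : ℂ)) (L F)) ∂P := by
          refine integral_congr_ae ?_
          filter_upwards [hall, heval F] with ω h1 h2
          rw [map_mul, aeval_X, h2, h1, Finset.sum_mul]
          simp only [mul_assoc]
      _ = ∑ k, M a k * (u k * ∑ c, M c k * ∫ ω, aeval (fun k => (ξ k ω : ℂ)) (L (pderiv c F)) ∂P) := by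
          rw [integral_finsetSum]
          · refine Finset.sum_congr rfl fun k _ => ?_
            rw [integral_const_mul, hstein, hL, pderiv_linearSubst]
            simp only [map_sum, map_mul, aeval_C]
            rw [integral_finsetSum _ fun c _ => (hint _).const_mul _]
            simp only [integral_const_mul]
            rfl
          · exact fun k _ =>
              ((hmom k).mul (HasMoments.aeval hmom (L F))).integrable.const_mul (M a k)
      _ = ∑ c, (∑ k, M a k * (u k * M c k)) *
            ∫ ω, aeval (fun k => (ξ k ω : ℂ)) (L (pderiv c F)) ∂P := by
          simp only [Finset.mul_sum, Finset.sum_mul]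
          rw [Finset.sum_comm]
          refine Finset.sum_congr rfl fun c _ => Finset.sum_congr rfl fun k _ => ?_
          ring
      -- The bracketed sum is the covariance of `Z a` and `Z c`, which vanishes unless `c = τ a`.
      _ = v a * ∫ ω, aeval (fun k => (ξ k ω : ℂ)) (L (pderiv (τ a) F)) ∂P := by
          simp only [hcov]
          rw [Finset.sum_eq_single (τ a)]
          · simp
          · intro b _ hb
            simp [hb]
          · simp
      _ = _ := by rw [integral_congr_ae (heval _)]
  simp only [expectation, LinearMap.coe_mk, AddHom.coe_mk, key]
  rw [← Complex.re_ofReal_mul]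

end Gaussian

/-! ### Moment and variance bounds for the Gaussian matrix model -/

section Concentration

open MvPolynomial
open Finset.HasAntidiagonal (antidiagonal)
open scoped Matrix

variable {σ I : Type*} [Fintype σ] [Fintype I] [DecidableEq I]

/-- Structural data of a Gaussian random matrix `∑ c, Z c • B c`, where `Z (τ c)` is the conjugate
of `Z c`, `B (τ c)` the transpose of `B c`, and `v c` the variance of `Z c`. -/
structure IsModel (τ : σ → σ) (v : σ → ℝ≥0) (B : σ → Matrix I I ℝ≥0) (m : ℕ) (γ : ℝ) : Prop where
  involutive : Function.Involutive τ
  var_tau : ∀ c, v (τ c) = v c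
  matrix_tau : ∀ c, B (τ c) = (B c)ᵀ
  row : ∑ c, v c • (B c * (B c)ᵀ) = (m : ℝ≥0) • (1 : Matrix I I ℝ≥0)
  sum_le : ∀ x y, ∑ c, B c x y ≤ m
  entry_le : ∀ c, (v c : ℝ) * ∑ x, ∑ y, (B c x y : ℝ) ≤ γ

/-- The matrix `∑ c, z c • B c`. -/
noncomputable def linearMatrix (B : σ → Matrix I I ℝ≥0) (z : σ → ℂ) : Matrix I I ℂ :=
  Matrix.of fun x y => ∑ c, z c * ((B c x y : ℝ) : ℂ)

/-- A matrix of nonnegative reals, seen as a complex matrix. -/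
noncomputable def complexMatrix (M : Matrix I I ℝ≥0) : Matrix I I ℂ :=
  M.map (algebraMap ℝ≥0 ℂ)

omit [Fintype I] [DecidableEq I] in
theorem complexMatrix_apply (M : Matrix I I ℝ≥0) (x y : I) :
    complexMatrix M x y = ((M x y : ℝ) : ℂ) := rfl

omit [Fintype I] [DecidableEq I] in
theorem complexMatrix_transpose (M : Matrix I I ℝ≥0) :
    complexMatrix Mᵀ = (complexMatrix M)ᴴ := by
  ext x y
  simp [complexMatrix_apply]

omit [Fintype σ] in
theorem mapMatrix_constMatrix (z : σ → ℂ) (M : Matrix I I ℝ≥0) :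
    (aeval z : MvPolynomial σ ℝ≥0 →ₐ[ℝ≥0] ℂ).mapMatrix (constMatrix σ M) = complexMatrix M := by
  ext x y
  simp [constMatrix, complexMatrix]

theorem mapMatrix_formalMatrix (B : σ → Matrix I I ℝ≥0) (z : σ → ℂ) :
    (aeval z : MvPolynomial σ ℝ≥0 →ₐ[ℝ≥0] ℂ).mapMatrix (formalMatrix B) = linearMatrix B z := by
  ext x y
  simp [formalMatrix, linearMatrix]
  rfl

omit [Fintype σ] in
theorem aeval_trace (z : σ → ℂ) (M : Matrix I I (MvPolynomial σ ℝ≥0)) :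
    aeval z M.trace =
      ((aeval z : MvPolynomial σ ℝ≥0 →ₐ[ℝ≥0] ℂ).mapMatrix M).trace := by
  simp [Matrix.trace]

namespace IsModel

variable {τ : σ → σ} {v : σ → ℝ≥0} {B : σ → Matrix I I ℝ≥0} {m : ℕ} {γ : ℝ}

theorem isHermitian (h : IsModel τ v B m γ) {z : σ → ℂ}
    (hz : ∀ c, z (τ c) = starRingEnd ℂ (z c)) : (linearMatrix B z).IsHermitian := by
  ext x y
  simp only [linearMatrix, Matrix.conjTranspose_apply, Matrix.of_apply, star_sum, star_mul',
    RCLike.star_def, Complex.conj_ofReal]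
  refine Fintype.sum_equiv h.involutive.toPerm _ _ fun c => ?_
  simp [hz, h.matrix_tau]

theorem complex_row (h : IsModel τ v B m γ) :
    ∑ c, (v c : ℂ) • (complexMatrix (B c) * (complexMatrix (B c))ᴴ) = ((m : ℝ) : ℂ) • 1 := by
  have := congrArg (fun M => (algebraMap ℝ≥0 ℂ).mapMatrix M) h.row
  ext x y
  have h2 := congrFun (congrFun this x) y
  simp only [RingHom.mapMatrix_apply, Matrix.map_apply, Matrix.sum_apply, Matrix.smul_apply,
    map_sum, smul_eq_mul, map_mul, Matrix.mul_apply, Matrix.transpose_apply, map_natCast] at h2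
  simp only [← complexMatrix_transpose]
  simp only [Matrix.sum_apply, Matrix.smul_apply, smul_eq_mul, Matrix.mul_apply,
    complexMatrix, Matrix.map_apply, Matrix.transpose_apply,
    Complex.ofReal_natCast]
  refine h2.trans ?_
  by_cases hxy : x = y <;> simp [Matrix.one_apply, hxy]

theorem complex_col (h : IsModel τ v B m γ) :
    ∑ c, (v c : ℂ) • ((complexMatrix (B c))ᴴ * complexMatrix (B c)) = ((m : ℝ) : ℂ) • 1 := by
  rw [← h.complex_row]
  refine Fintype.sum_equiv h.involutive.toPerm _ _ fun c => ?_
  simp only [Function.Involutive.coe_toPerm, h.var_tau, h.matrix_tau, complexMatrix_transpose,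
    Matrix.conjTranspose_conjTranspose]

theorem row_apply (h : IsModel τ v B m γ) (x : I) :
    ∑ c, v c * ∑ y, B c x y * B (τ c) y x = m := by
  have h1 := congrFun (congrFun h.row x) x
  rw [Matrix.sum_apply] at h1
  simpa [Matrix.mul_apply, h.matrix_tau] using h1

/-- A Bessel type inequality for the matrices `B c`. -/
theorem sum_normSq_trace_le (h : IsModel τ v B m γ) (A : Matrix I I ℂ) :
    ∑ c, v c * Complex.normSq (A * complexMatrix (B c)).trace ≤
      γ * (m * ∑ x, ∑ y, Complex.normSq (A x y)) := by
  -- Cauchy–Schwarz with the entries of `B c` as weights. The total weight is then controlled by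
  -- `entry_le`, and the sum over `c` of the weighted squares by `sum_le`.
  have hcs : ∀ c, Complex.normSq (A * complexMatrix (B c)).trace ≤
      (∑ x, ∑ y, (B c x y : ℝ)) * ∑ x, ∑ y, (B c y x : ℝ) * Complex.normSq (A x y) := by
    intro c
    have h1 : ‖(A * complexMatrix (B c)).trace‖ ≤ ∑ p : I × I, (B c p.2 p.1 : ℝ) * ‖A p.1 p.2‖ := by
      rw [Fintype.sum_prod_type]
      refine (norm_sum_le _ _).trans (Finset.sum_le_sum fun x _ => ?_)
      rw [Matrix.diag_apply, Matrix.mul_apply]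
      refine (norm_sum_le _ _).trans (Finset.sum_le_sum fun y _ => ?_)
      rw [complexMatrix_apply, norm_mul, Complex.norm_real, mul_comm]
      simp
    have h2 := Finset.sum_sq_le_sum_mul_sum_of_sq_le_mul (Finset.univ : Finset (I × I))
      (r := fun p => (B c p.2 p.1 : ℝ) * ‖A p.1 p.2‖) (f := fun p => (B c p.2 p.1 : ℝ))
      (g := fun p => (B c p.2 p.1 : ℝ) * ‖A p.1 p.2‖ ^ 2) (fun _ _ => by positivity)
      (fun _ _ => by positivity) (fun _ _ => le_of_eq (by ring))
    rw [Complex.normSq_eq_norm_sq]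
    refine (pow_le_pow_left₀ (norm_nonneg _) h1 2).trans (h2.trans_eq ?_)
    simp only [Fintype.sum_prod_type, Complex.normSq_eq_norm_sq]
    congr 1
    rw [Finset.sum_comm]
  -- Nonnegativity of `γ` is read off from some `c₀`. Without any `c`, either `I` is empty or `row`
  -- forces `m = 0`.
  rcases isEmpty_or_nonempty σ with hσ | ⟨⟨c₀⟩⟩
  · rcases isEmpty_or_nonempty I with hI | ⟨⟨x₀⟩⟩
    · simp
    · have h1 := h.row_apply x₀
      have h2 : (m : ℝ≥0) = 0 := by rw [← h1]; simp
      have h3 : m = 0 := by exact_mod_cast h2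
      simp [h3]
  have hγ : 0 ≤ γ := le_trans (by positivity) (h.entry_le c₀)
  calc ∑ c, v c * Complex.normSq (A * complexMatrix (B c)).trace
      ≤ ∑ c, γ * ∑ x, ∑ y, (B c y x : ℝ) * Complex.normSq (A x y) := by
        refine Finset.sum_le_sum fun c _ => ?_
        refine (mul_le_mul_of_nonneg_left (hcs c) (v c).2).trans ?_
        rw [← mul_assoc]
        refine mul_le_mul_of_nonneg_right (h.entry_le c) ?_
        exact Finset.sum_nonneg fun x _ => Finset.sum_nonneg fun y _ =>
          mul_nonneg (by positivity) (Complex.normSq_nonneg _)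
    _ = γ * ∑ x, ∑ y, (∑ c, (B c y x : ℝ)) * Complex.normSq (A x y) := by
        rw [← Finset.mul_sum, Finset.sum_comm]
        congr 1
        refine Finset.sum_congr rfl fun x _ => ?_
        rw [Finset.sum_comm]
        simp only [Finset.sum_mul]
    _ ≤ γ * ∑ x, ∑ y, (m : ℝ) * Complex.normSq (A x y) := by
        refine mul_le_mul_of_nonneg_left (Finset.sum_le_sum fun x _ => Finset.sum_le_sum fun y _ =>
          mul_le_mul_of_nonneg_right ?_ (Complex.normSq_nonneg _)) hγ
        exact_mod_cast h.sum_le y x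
    _ = _ := by simp only [Finset.mul_sum]

variable {Ω : Type*} [MeasurableSpace Ω] {P : Measure Ω} [IsProbabilityMeasure P]
  {Z : σ → Ω → ℂ} {hZ : ∀ c, HasMoments P (Z c)}

omit [Fintype σ] in
theorem _root_.LocalGUE.expectation_apply (F : MvPolynomial σ ℝ≥0) :
    expectation P hZ F = ∫ ω, (aeval (fun c => Z c ω) F).re ∂P :=
  (integral_re (𝕜 := ℂ) (HasMoments.aeval hZ F).integrable).symm

omit [Fintype σ] in
theorem _root_.LocalGUE.integrable_re_aeval (hZ : ∀ c, HasMoments P (Z c))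
    (F : MvPolynomial σ ℝ≥0) : Integrable (fun ω => (aeval (fun c => Z c ω) F).re) P :=
  (HasMoments.aeval hZ F).integrable.re

/-- The bound `(2 q - 1)!! * (2 m) ^ q` for the normalized moment of order `2 q`. -/
noncomputable def _root_.LocalGUE.momentBound (m : ℕ) : ℕ → ℝ
  | 0 => 1
  | q + 1 => (2 * q + 1) * (2 * m) * momentBound m q

/-- One integration by parts pairs the first factor with each of the `2q + 1` others, and
`sum_trace_mul_pow_le` bounds each contribution by `2m` times the previous trace moment. The bound
is crude, but its normalized form does not depend on the dimension. -/
theorem expectation_trace_pow_le (h : IsModel τ v B m γ) (hW : IsWick τ v (expectation P hZ))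
    (hconj : ∀ᵐ ω ∂P, ∀ c, Z (τ c) ω = starRingEnd ℂ (Z c ω)) (q : ℕ) :
    expectation P hZ (formalMatrix B ^ (2 * q)).trace ≤ momentBound m q * Fintype.card I := by
  induction q with
  | zero =>
    simp only [mul_zero, pow_zero, Matrix.trace_one, momentBound, one_mul]
    rw [← map_natCast (C : ℝ≥0 →+* MvPolynomial σ ℝ≥0), hW.map_C]
    simp
  | succ q ih =>
    have hstep : expectation P hZ (formalMatrix B ^ (2 * q + 2)).trace ≤
        (2 * q + 1) * (2 * m) * expectation P hZ (formalMatrix B ^ (2 * q)).trace := by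
      rw [hW.trace_formalMatrix_pow]
      simp only [Finset.mul_sum]
      rw [Finset.sum_comm]
      have hle : ∀ ij ∈ antidiagonal (2 * q), ∑ c, (v c : ℝ) * expectation P hZ
          (constMatrix σ (B c) * formalMatrix B ^ ij.1 * constMatrix σ (B (τ c)) *
            formalMatrix B ^ ij.2).trace ≤
          2 * m * expectation P hZ (formalMatrix B ^ (2 * q)).trace := by
        intro ij hij
        have hij := Finset.HasAntidiagonal.mem_antidiagonal.1 hij
        simp only [expectation_apply, ← integral_const_mul]
        rw [← integral_finsetSum _ fun c _ => (integrable_re_aeval hZ _).const_mul _]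
        refine integral_mono_ae (integrable_finsetSum _ fun c _ =>
          (integrable_re_aeval hZ _).const_mul _) ((integrable_re_aeval hZ _).const_mul _) ?_
        filter_upwards [hconj] with ω hω
        simp only [aeval_trace, map_mul, map_pow, mapMatrix_constMatrix, mapMatrix_formalMatrix,
          h.matrix_tau, complexMatrix_transpose]
        exact sum_trace_mul_pow_le v _ m h.complex_row h.complex_col (h.isHermitian hω) hij
      refine (Finset.sum_le_sum hle).trans_eq ?_
      rw [Finset.sum_const, Finset.Nat.card_antidiagonal, nsmul_eq_mul]
      push_cast
      ring
    refine hstep.trans ?_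
    rw [momentBound, mul_assoc _ (momentBound m q)]
    exact mul_le_mul_of_nonneg_left ih (by positivity)

/-- Poincaré's inequality: the gradient of `tr H^(p+1)` has components `(p + 1) tr (H^p B c)`, and
the Bessel bound controls their weighted squares by `γ m tr H^(2p)`. -/
theorem variance_trace_pow_le (h : IsModel τ v B m γ) (hW : IsWick τ v (expectation P hZ))
    (hconj : ∀ᵐ ω ∂P, ∀ c, Z (τ c) ω = starRingEnd ℂ (Z c ω)) (p : ℕ) :
    Var[fun ω => (linearMatrix B (fun c => Z c ω) ^ (p + 1)).trace.re; P] ≤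
      (p + 1) ^ 2 * (γ * m) *
        expectation P hZ (formalMatrix B ^ (2 * p)).trace := by
  set F := (formalMatrix B ^ (p + 1)).trace with hF
  have hFe : ∀ ω, (linearMatrix B (fun c => Z c ω) ^ (p + 1)).trace =
      aeval (fun c => Z c ω) F := by
    intro ω
    rw [hF, aeval_trace, map_pow, mapMatrix_formalMatrix]
  simp only [hFe]
  have hmem : MemLp (fun ω => (aeval (fun c => Z c ω) F).re) 2 P :=
    (HasMoments.aeval hZ F 2).re
  rw [variance_eq_sub hmem]
  -- The trace is almost surely real, so the square of its real part is the real part of its square.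
  have hsq : ∫ ω, (aeval (fun c => Z c ω) F).re ^ 2 ∂P = expectation P hZ (F * F) := by
    rw [expectation_apply]
    refine integral_congr_ae ?_
    filter_upwards [hconj] with ω hω
    rw [map_mul, ← hFe, (h.isHermitian hω).trace_pow_eq_sum_eigenvalues, ← Complex.ofReal_mul,
      Complex.ofReal_re, Complex.ofReal_re, sq]
  have hcov := hW.covariance_le F F
  have hgrad : ∑ c, v c * expectation P hZ (pderiv c F * pderiv (τ c) F) ≤
      (p + 1) ^ 2 * (γ * m) * expectation P hZ (formalMatrix B ^ (2 * p)).trace := by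
    simp only [expectation_apply, ← integral_const_mul]
    rw [← integral_finsetSum _ fun c _ => (integrable_re_aeval hZ _).const_mul _]
    refine integral_mono_ae (integrable_finsetSum _ fun c _ =>
      (integrable_re_aeval hZ _).const_mul _) ((integrable_re_aeval hZ _).const_mul _) ?_
    filter_upwards [hconj] with ω hω
    have hH := h.isHermitian (z := fun c => Z c ω) hω
    set H := linearMatrix B fun c => Z c ω
    have hterm : ∀ c, (aeval (fun c => Z c ω) (pderiv c F * pderiv (τ c) F)).re =
        (p + 1) ^ 2 * Complex.normSq (H ^ p * complexMatrix (B c)).trace := by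
      intro c
      rw [hF, pderiv_trace_formalMatrix_pow, pderiv_trace_formalMatrix_pow]
      simp only [map_mul, aeval_trace, map_pow, mapMatrix_constMatrix, mapMatrix_formalMatrix,
        map_add, map_natCast, map_one, h.matrix_tau, complexMatrix_transpose]
      have hstar : (H ^ p * (complexMatrix (B c))ᴴ).trace =
          starRingEnd ℂ (H ^ p * complexMatrix (B c)).trace := by
        rw [Matrix.trace_mul_comm, ← RCLike.star_def, ← Matrix.trace_conjTranspose,
          Matrix.conjTranspose_mul, (hH.pow p).eq]
      rw [hstar, mul_mul_mul_comm, Complex.mul_conj, ← sq]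
      rw [show ((p : ℂ) + 1) ^ 2 = (((p : ℝ) + 1) ^ 2 : ℝ) by push_cast; rfl,
        ← Complex.ofReal_mul, Complex.ofReal_re]
    have htr : (H ^ (2 * p)).trace.re = ∑ x, ∑ y, Complex.normSq ((H ^ p) x y) := by
      rw [two_mul, pow_add]
      nth_rewrite 2 [← (hH.pow p).eq]
      simp only [Matrix.trace, Matrix.diag_apply, Matrix.mul_apply, Matrix.conjTranspose_apply,
        RCLike.star_def, Complex.mul_conj, Complex.re_sum, Complex.ofReal_re]
    simp only [hterm, aeval_trace, map_pow, mapMatrix_formalMatrix]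
    rw [htr]
    have := mul_le_mul_of_nonneg_left (h.sum_normSq_trace_le (H ^ p))
      (show (0 : ℝ) ≤ (p + 1) ^ 2 by positivity)
    refine le_trans (le_of_eq ?_) (this.trans_eq (by ring))
    rw [Finset.mul_sum]
    refine Finset.sum_congr rfl fun c _ => ?_
    ring
  have hE : (∫ ω, (aeval (fun c => Z c ω) F).re ∂P) = expectation P hZ F :=
    (expectation_apply F).symm
  simp only [Pi.pow_apply]
  rw [hsq, hE, sq]
  linarith

/-- Normalized moments of the random matrix are unlikely to be much below those of the semicircle
distribution. -/
theorem measure_trace_pow_lt_le [Nonempty I] (h : IsModel τ v B m γ)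
    (hW : IsWick τ v (expectation P hZ))
    (hconj : ∀ᵐ ω ∂P, ∀ c, Z (τ c) ω = starRingEnd ℂ (Z c ω)) (p : ℕ) {η : ℝ} (hη : 0 < η) {d : ℝ}
    (hγ : γ ≤ (Fintype.card I : ℝ) / d ^ 2) :
    P {ω | (linearMatrix B (fun c => Z c ω) ^ (p + 1)).trace.re / (Fintype.card I : ℝ) <
        semicircleMoment m (p + 1) - η} ≤
      ENNReal.ofReal ((p + 1) ^ 2 * m * momentBound m p / η ^ 2 * (1 / d ^ 2)) := by
  set D : ℝ := (Fintype.card I : ℝ) with hD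
  have hD0 : 0 < D := by rw [hD]; exact_mod_cast Fintype.card_pos
  set T : Ω → ℝ := fun ω => (linearMatrix B (fun c => Z c ω) ^ (p + 1)).trace.re with hT
  have hFe : ∀ ω, T ω = (aeval (fun c => Z c ω) (formalMatrix B ^ (p + 1)).trace).re := by
    intro ω
    rw [aeval_trace, map_pow, mapMatrix_formalMatrix]
  have hmem : MemLp T 2 P := by
    simp only [funext hFe]
    exact (HasMoments.aeval hZ _ 2).re
  have hmean : D * semicircleMoment m (p + 1) ≤ ∫ ω, T ω ∂P := by
    simp only [hFe]
    rw [← expectation_apply (hZ := hZ), Matrix.trace, map_sum]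
    have hx : ∀ x, semicircleMoment m (p + 1) ≤
        expectation P hZ ((formalMatrix B ^ (p + 1)).diag x) := by
      intro x
      rw [semicircleMoment, Matrix.diag_apply]
      split_ifs with he
      · have hp : p + 1 = 2 * ((p + 1) / 2) := (Nat.two_mul_div_two_of_even he).symm
        conv_rhs => rw [hp]
        exact hW.catalan_le B m h.row_apply _ x
      · exact hW.nonneg _
    calc D * semicircleMoment m (p + 1) = ∑ _x : I, semicircleMoment m (p + 1) := by
          rw [Finset.sum_const, nsmul_eq_mul]; rfl
      _ ≤ _ := Finset.sum_le_sum fun x _ => hx x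
  have hvar : Var[T; P] ≤ (p + 1) ^ 2 * m * momentBound m p * D * (D / d ^ 2) := by
    refine (h.variance_trace_pow_le hW hconj p).trans ?_
    have h1 := h.expectation_trace_pow_le hW hconj p
    have h0 := hW.nonneg (formalMatrix B ^ (2 * p)).trace
    calc ((p : ℝ) + 1) ^ 2 * (γ * m) * expectation P hZ (formalMatrix B ^ (2 * p)).trace
        ≤ (p + 1) ^ 2 * (D / d ^ 2 * m) * (momentBound m p * D) := by gcongr
      _ = _ := by ring
  -- The mean is already at least `D` times the semicircle moment, so falling short by `η` forces a
  -- deviation from the mean.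
  have hsub : {ω | T ω / D < semicircleMoment m (p + 1) - η} ⊆
      {ω | η * D ≤ |T ω - ∫ ω, T ω ∂P|} := by
    intro ω hω
    simp only [Set.mem_ofPred_eq, div_lt_iff₀ hD0] at hω ⊢
    rw [abs_sub_comm]
    refine le_trans ?_ (le_abs_self _)
    nlinarith
  refine (measure_mono hsub).trans ((meas_ge_le_variance_div_sq hmem (by positivity)).trans ?_)
  refine ENNReal.ofReal_le_ofReal ?_
  rw [div_le_iff₀ (by positivity)]
  refine hvar.trans_eq ?_
  field_simp

end IsModel

end Concentration

/-! ### Hermitian Gaussian families in terms of independent real coordinates -/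

section HalfCoordinates

variable {σ : Type*} [Fintype σ] [DecidableEq σ] (τ : σ → σ) (S T : σ → Prop)
  [DecidablePred S] [DecidablePred T]

/-- Of `c` and `τ c`, one that satisfies `S`. -/
def lowerRep (c : σ) : σ := if S c then c else τ c

/-- The coefficients of the entry `c` of a Hermitian family in terms of the real parts of the
entries satisfying `S` and the imaginary parts of those satisfying `T`. -/
noncomputable def coordCoeff (c : σ) : {c // S c} ⊕ {c // T c} → ℂ
  | .inl p => if p.1 = lowerRep τ S c then 1 else 0
  | .inr p => if p.1 = lowerRep τ S c then (if S c then Complex.I else -Complex.I) else 0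

/-- The real parts of the entries satisfying `S` and the imaginary parts of those satisfying `T`. -/
def halfCoord (z : σ → ℂ) : {c // S c} ⊕ {c // T c} → ℝ
  | .inl p => (z p.1).re
  | .inr p => (z p.1).im

/-- The variances of the real coordinates of a Hermitian Gaussian family. -/
noncomputable def halfVar (v : σ → ℝ≥0) : {c // S c} ⊕ {c // T c} → ℝ≥0
  | .inl p => if τ p.1 = p.1 then v p.1 else v p.1 / 2
  | .inr p => v p.1 / 2

variable {τ S T}

theorem sum_coordCoeff_mul (hS : ∀ c, S c ∨ S (τ c)) (c : σ)
    (f : {c // S c} ⊕ {c // T c} → ℂ) :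
    ∑ k, coordCoeff τ S T c k * f k =
      (if h : S (lowerRep τ S c) then f (.inl ⟨_, h⟩) else 0) +
        if h : T (lowerRep τ S c) then
          (if S c then Complex.I else -Complex.I) * f (.inr ⟨_, h⟩) else 0 := by
  have hr : S (lowerRep τ S c) := by
    unfold lowerRep
    split_ifs with h
    · exact h
    · exact (hS c).resolve_left h
  rw [Fintype.sum_sum_type]
  congr 1
  · rw [dif_pos hr, Finset.sum_eq_single ⟨_, hr⟩]
    · simp [coordCoeff]
    · intro b _ hb
      have : b.1 ≠ lowerRep τ S c := fun h => hb (Subtype.ext h)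
      simp [coordCoeff, this]
    · simp
  · split_ifs with hT h
    · rw [Finset.sum_eq_single ⟨_, hT⟩]
      · simp [coordCoeff, h]
      · intro b _ hb
        have : b.1 ≠ lowerRep τ S c := fun h => hb (Subtype.ext h)
        simp [coordCoeff, this]
      · simp
    · rw [Finset.sum_eq_single ⟨_, hT⟩]
      · simp [coordCoeff, h]
      · intro b _ hb
        have : b.1 ≠ lowerRep τ S c := fun h => hb (Subtype.ext h)
        simp [coordCoeff, this]
      · simp
    · refine Finset.sum_eq_zero fun b _ => ?_
      have : b.1 ≠ lowerRep τ S c := fun h => hT (h ▸ b.2)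
      simp [coordCoeff, this]

theorem sum_coordCoeff_mul_halfCoord (hτ : Function.Involutive τ) (hS : ∀ c, S c ∨ S (τ c))
    (hT : ∀ c, T c ↔ S c ∧ τ c ≠ c) {z : σ → ℂ} (hz : ∀ c, z (τ c) = starRingEnd ℂ (z c)) (c : σ) :
    ∑ k, coordCoeff τ S T c k * (halfCoord S T z k : ℂ) = z c := by
  have hfix : ∀ c, τ c = c → (z c).im = 0 := fun c h => by
    have := congrArg Complex.im (hz c)
    rw [h, Complex.conj_im] at this
    linarith
  rw [sum_coordCoeff_mul hS]
  by_cases hc : S c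
  · have hr : lowerRep τ S c = c := if_pos hc
    simp only [hr, hc, if_true, dif_pos, halfCoord, hT, true_and]
    by_cases hd : τ c = c
    · apply Complex.ext <;> simp [hd, hfix c hd]
    · apply Complex.ext <;> simp [hd]
  · have hr : lowerRep τ S c = τ c := if_neg hc
    have hs : S (τ c) := (hS c).resolve_left hc
    have hd : c ≠ τ c := fun h => hc (h ▸ hs)
    simp only [hr, hc, hs, if_false, dif_pos, halfCoord, hT, hτ c, hd, ne_eq, not_false_eq_true,
      and_self, hz]
    apply Complex.ext <;> simp

/-- Off the diagonal the real and imaginary parts each have variance `v c / 2`: their contributions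
cancel in the covariance of `Z c` with itself and add up in that of `Z c` with `Z (τ c)`. -/
theorem sum_coordCoeff_covariance (hτ : Function.Involutive τ) (hS : ∀ c, S c ∨ S (τ c))
    (hS' : ∀ c, S c → S (τ c) → τ c = c)
    (hT : ∀ c, T c ↔ S c ∧ τ c ≠ c) {v : σ → ℝ≥0} (hv : ∀ c, v (τ c) = v c) (c c' : σ) :
    ∑ k, coordCoeff τ S T c k * (halfVar τ S T v k * coordCoeff τ S T c' k) =
      Set.indicator {τ c} (fun _ => (v c : ℂ)) c' := by
  rw [sum_coordCoeff_mul hS]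
  have key : ∀ c', lowerRep τ S c = lowerRep τ S c' ↔ c' = c ∨ c' = τ c := by
    intro c'
    unfold lowerRep
    constructor
    · split_ifs with h h' h'
      · exact fun e => .inl e.symm
      · rintro rfl; exact .inr (hτ c').symm
      · exact fun e => .inr e.symm
      · exact fun e => .inl (hτ.injective e.symm)
    · rintro (rfl | rfl)
      · rfl
      · by_cases h : S c
        · by_cases h' : S (τ c)
          · rw [if_pos h, if_pos h', hS' c h h']
          · rw [if_pos h, if_neg h', hτ]
        · rw [if_neg h, if_pos ((hS c).resolve_left h)]
  by_cases hc' : lowerRep τ S c = lowerRep τ S c'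
  · by_cases hd : τ c = c
    · have hcc : c' = c := by rcases (key c').1 hc' with h | h <;> simp [h, hd]
      have hs : S c := by rcases hS c with h | h; exacts [h, hd ▸ h]
      subst hcc
      have hr : lowerRep τ S c' = c' := if_pos hs
      simp only [hr, hT, hs, hd, halfVar, coordCoeff]
      simp
    · rcases (key c').1 hc' with rfl | rfl
      · have hne : ¬ c' = τ c' := fun h => hd h.symm
        by_cases hs : S c'
        · have hr : lowerRep τ S c' = c' := if_pos hs
          simp only [hr, hT, hs, hd, halfVar, coordCoeff, Set.indicator, Set.mem_singleton_iff, hne]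
          simp only [dif_pos, if_true, if_false, ne_eq, true_and, hd, not_false_eq_true,
            mul_one]
          push_cast
          linear_combination ((v c' : ℂ) / 2) * Complex.I_mul_I
        · have hr : lowerRep τ S c' = τ c' := if_neg hs
          have hs' : S (τ c') := (hS c').resolve_left hs
          simp only [hr, hT, hs, hs', hτ c', hne, halfVar, coordCoeff, Set.indicator,
            Set.mem_singleton_iff, hv]
          simp only [dif_pos, if_true, if_false, ne_eq, true_and, hne, not_false_eq_true,
            mul_one]
          push_cast
          linear_combination ((v c' : ℂ) / 2) * Complex.I_mul_I
      · have hne : ¬ c = τ c := fun h => hd h.symm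
        by_cases hs : S c
        · have hs' : ¬ S (τ c) := fun h => hd (hS' c hs h)
          have hr : lowerRep τ S c = c := if_pos hs
          have hr' : lowerRep τ S (τ c) = c := by rw [lowerRep, if_neg hs', hτ]
          simp only [hr, hr', hT, hs, hs', hd, halfVar, coordCoeff, Set.indicator,
            Set.mem_singleton_iff]
          simp only [dif_pos, if_true, if_false, ne_eq, true_and, hd, not_false_eq_true,
            mul_one]
          push_cast
          linear_combination -((v c : ℂ) / 2) * Complex.I_mul_I
        · have hs' : S (τ c) := (hS c).resolve_left hs
          have hr : lowerRep τ S c = τ c := if_neg hs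
          have hr' : lowerRep τ S (τ c) = τ c := if_pos hs'
          simp only [hr, hr', hT, hs, hs', hτ c, hne, halfVar, coordCoeff, Set.indicator,
            Set.mem_singleton_iff, hv]
          simp only [dif_pos, if_true, if_false, ne_eq, true_and, hne, not_false_eq_true,
            mul_one]
          push_cast
          linear_combination -((v c : ℂ) / 2) * Complex.I_mul_I
  · have h1 : c' ≠ τ c := fun h => hc' ((key c').2 (.inr h))
    simp [coordCoeff, hc', h1, Set.indicator]

variable {Ω : Type*} [MeasurableSpace Ω] {P : Measure Ω}

theorem _root_.ProbabilityTheory.HasLaw.hasMoments_gaussianReal {X : Ω → ℝ} {v : ℝ≥0}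
    (hX : HasLaw X (gaussianReal 0 v) P) : HasMoments P fun ω => (X ω : ℂ) := by
  intro p
  refine MemLp.ofReal ?_
  have h := memLp_id_gaussianReal (μ := 0) (v := v) p
  rw [← hX.map_eq] at h
  exact h.comp_of_map hX.aemeasurable

variable [IsProbabilityMeasure P]

/-- A Hermitian family with independent Gaussian real coordinates satisfies the integration by
parts formula. -/
theorem exists_isWick_of_halfCoord (hτ : Function.Involutive τ) (hS : ∀ c, S c ∨ S (τ c))
    (hS' : ∀ c, S c → S (τ c) → τ c = c) (hT : ∀ c, T c ↔ S c ∧ τ c ≠ c) {v : σ → ℝ≥0}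
    (hv : ∀ c, v (τ c) = v c) (hv0 : ∀ c, v c ≠ 0) {Z : σ → Ω → ℂ}
    (hconj : ∀ᵐ ω ∂P, ∀ c, Z (τ c) ω = starRingEnd ℂ (Z c ω))
    (hlaw : ∀ k, HasLaw (fun ω => halfCoord S T (fun c => Z c ω) k)
      (gaussianReal 0 (halfVar τ S T v k)) P)
    (hprod : ∀ α : {c // S c} ⊕ {c // T c} → ℕ,
      ∫ ω, ∏ k, halfCoord S T (fun c => Z c ω) k ^ α k ∂P =
        ∏ k, ∫ ω, halfCoord S T (fun c => Z c ω) k ^ α k ∂P) :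
    ∃ hZ : ∀ c, HasMoments P (Z c), IsWick τ v (expectation P hZ) := by
  have hmom := fun k => (hlaw k).hasMoments_gaussianReal
  have hZM : ∀ c, Z c =ᵐ[P] fun ω =>
      ∑ k, coordCoeff τ S T c k * (halfCoord S T (fun c => Z c ω) k : ℂ) := by
    intro c
    filter_upwards [hconj] with ω hω
    exact (sum_coordCoeff_mul_halfCoord hτ hS hT (z := fun c => Z c ω) hω c).symm
  have hZ : ∀ c, HasMoments P (Z c) := by
    intro c
    refine HasMoments.congr (HasMoments.aeval hmom
      (∑ k, MvPolynomial.C (coordCoeff τ S T c k) * MvPolynomial.X k)) ?_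
    filter_upwards [hZM c] with ω hω
    rw [hω]
    simp
  refine ⟨hZ, isWick_expectation ?_ hlaw hprod hmom (coordCoeff τ S T)
    (sum_coordCoeff_covariance hτ hS hS' hT hv) hZ hZM⟩
  rintro (p | p)
  · simp only [halfVar]
    split_ifs
    · exact hv0 _
    · exact div_ne_zero (hv0 _) two_ne_zero
  · exact div_ne_zero (hv0 _) two_ne_zero

end HalfCoordinates

/-! ### The local GUE Hamiltonian as a model, and Borel–Cantelli -/

section Local

variable {n m d : ℕ} (K : Fin m → Finset (Fin n))

/-- The labels of the entries of all the local matrices. -/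
abbrev EntryIndex (d : ℕ) : Type := Σ ι : Fin m, (K ι → Fin d) × (K ι → Fin d)

variable {K}

/-- Transposition of an entry. -/
def swapEntry (c : EntryIndex K d) : EntryIndex K d := ⟨c.1, c.2.swap⟩

theorem swapEntry_involutive : Function.Involutive (swapEntry (K := K) (d := d)) := fun _ => rfl

/-- The variance of an entry. -/
noncomputable def entryVar (c : EntryIndex K d) : ℝ≥0 :=
  1 / (Fintype.card (K c.1 → Fin d) : ℝ≥0)

/-- The matrix unit of an entry, tensored with the identity on the other sites. -/
def entryMatrix (c : EntryIndex K d) : Matrix (Fin n → Fin d) (Fin n → Fin d) ℝ≥0 :=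
  Matrix.of fun x y =>
    if ((fun s : K c.1 => x s) = c.2.1 ∧ (fun s : K c.1 => y s) = c.2.2) ∧
      ∀ s ∈ (K c.1)ᶜ, x s = y s then 1 else 0

theorem entryMatrix_swapEntry (c : EntryIndex K d) :
    entryMatrix (swapEntry c) = (entryMatrix c).transpose := by
  ext x y
  simp only [entryMatrix, swapEntry, Matrix.of_apply, Matrix.transpose_apply, Prod.fst_swap,
    Prod.snd_swap, eq_comm (a := x _), and_comm]

theorem sum_entryMatrix_apply {α : Type*} [NonAssocSemiring α] (φ : ℝ≥0 →+* α) (ι : Fin m)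
    (A : (K ι → Fin d) × (K ι → Fin d) → α) (x y : Fin n → Fin d) :
    ∑ p, A p * φ (entryMatrix ⟨ι, p⟩ x y) =
      if ∀ s ∈ (K ι)ᶜ, x s = y s then A (fun s => x s, fun s => y s) else 0 := by
  split_ifs with h
  · rw [Finset.sum_eq_single (fun s : K ι => x s, fun s : K ι => y s)]
    · simp only [entryMatrix, Matrix.of_apply]
      rw [if_pos ⟨⟨trivial, trivial⟩, h⟩]
      simp
    · intro p _ hp
      simp only [entryMatrix, Matrix.of_apply]
      rw [if_neg]
      · simp
      · rintro ⟨⟨h1, h2⟩, -⟩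
        exact hp (Prod.ext h1.symm h2.symm)
    · simp
  · refine Finset.sum_eq_zero fun p _ => ?_
    simp only [entryMatrix, Matrix.of_apply]
    rw [if_neg fun h' => h h'.2]
    simp

theorem hamiltonian_eq_linearMatrix (G : ∀ ι : Fin m, Matrix (K ι → Fin d) (K ι → Fin d) ℂ) :
    hamiltonian K G = linearMatrix entryMatrix fun c : EntryIndex K d => G c.1 c.2.1 c.2.2 := by
  ext x y
  simp only [hamiltonian, linearMatrix, localTerm, Matrix.sum_apply, Matrix.of_apply,
    Fintype.sum_sigma]
  refine Finset.sum_congr rfl fun ι _ => ?_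
  have h := sum_entryMatrix_apply (algebraMap ℝ≥0 ℂ) ι (fun p => G ι p.1 p.2) x y
  refine Eq.trans ?_ h.symm
  rw [Finset.prod_ite_zero]
  split_ifs <;> simp

theorem card_eq_off (ι : Fin m) (x : Fin n → Fin d) :
    (Finset.univ.filter fun z : Fin n → Fin d => ∀ s ∈ (K ι)ᶜ, x s = z s).card =
      Fintype.card (K ι → Fin d) := by
  have h : (Finset.univ.filter fun z : Fin n → Fin d => ∀ s ∈ (K ι)ᶜ, x s = z s) =
      Fintype.piFinset fun s => if s ∈ K ι then Finset.univ else {x s} := by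
    ext z
    simp only [Finset.mem_filter, Finset.mem_univ, true_and, Fintype.mem_piFinset,
      Finset.mem_compl]
    refine forall_congr' fun s => ?_
    split_ifs with hs <;> simp [hs, eq_comm]
  rw [h, Fintype.card_piFinset]
  simp only [apply_ite Finset.card, Finset.card_univ, Finset.card_singleton, Fintype.card_fin,
    Fintype.card_fun, Fintype.card_coe]
  rw [Finset.prod_ite, Finset.prod_const, Finset.prod_const_one, mul_one]
  simp

theorem card_restrict_eq_mul (ι : Fin m) (i : K ι → Fin d) :
    (Finset.univ.filter fun x : Fin n → Fin d => (fun s : K ι => x s) = i).card *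
      Fintype.card (K ι → Fin d) = Fintype.card (Fin n → Fin d) := by
  have h : (Finset.univ.filter fun x : Fin n → Fin d => (fun s : K ι => x s) = i) =
      Fintype.piFinset fun s => if hs : s ∈ K ι then {i ⟨s, hs⟩} else Finset.univ := by
    ext z
    simp only [Finset.mem_filter, Finset.mem_univ, true_and, Fintype.mem_piFinset, funext_iff,
      Subtype.forall]
    refine forall_congr' fun s => ?_
    split_ifs with hs <;> simp [hs]
  have hc : ∀ s, (if hs : s ∈ K ι then {i ⟨s, hs⟩} else Finset.univ : Finset (Fin d)).card =
      if s ∈ (K ι)ᶜ then d else 1 := by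
    intro s
    by_cases hs : s ∈ K ι <;> simp [hs]
  rw [h, Fintype.card_piFinset]
  simp only [hc, Fintype.card_fun, Fintype.card_fin, Fintype.card_coe]
  rw [Finset.prod_ite_mem, Finset.univ_inter, Finset.prod_const, ← pow_add, Finset.card_compl,
    Fintype.card_fin, Nat.sub_add_cancel (by simpa using Finset.card_le_univ (K ι))]

theorem isModel_entryMatrix (hd : 0 < d) (hK : ∀ ι, (K ι).Nonempty) :
    IsModel swapEntry entryVar (entryMatrix (K := K) (d := d)) m
      ((Fintype.card (Fin n → Fin d) : ℝ) / d ^ 2) where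
  involutive := swapEntry_involutive
  var_tau _ := rfl
  matrix_tau := entryMatrix_swapEntry
  sum_le x y := by
    rw [Fintype.sum_sigma]
    calc ∑ ι, ∑ p, entryMatrix (⟨ι, p⟩ : EntryIndex K d) x y ≤ ∑ _ι : Fin m, (1 : ℝ≥0) := by
          refine Finset.sum_le_sum fun ι _ => ?_
          have h := sum_entryMatrix_apply (K := K) (RingHom.id ℝ≥0) ι (fun _ => 1) x y
          simp only [one_mul, RingHom.id_apply] at h
          rw [h]
          split_ifs <;> simp
      _ = m := by simp
  entry_le c := by
    obtain ⟨ι, i, j⟩ := c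
    have : NeZero d := ⟨hd.ne'⟩
    set N : ℝ := (Fintype.card (K ι → Fin d) : ℝ) with hN
    have hN0 : 0 < N := by rw [hN]; exact_mod_cast Fintype.card_pos
    -- Since `K ι` is nonempty, `N = d ^ #(K ι)` is at least `d`. This is the source of the factor
    -- `d⁻²` in the variance.
    have hdN : (d : ℝ) ≤ N := by
      rw [hN, Fintype.card_fun, Fintype.card_fin, Fintype.card_coe]
      exact_mod_cast Nat.le_self_pow (Finset.card_pos.2 (hK ι)).ne' d
    have hrow : ∀ x, ∑ y, (entryMatrix (⟨ι, i, j⟩ : EntryIndex K d) x y : ℝ) ≤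
        if (fun s : K ι => x s) = i then 1 else 0 := by
      intro x
      set y₀ : Fin n → Fin d := fun s => if hs : s ∈ K ι then j ⟨s, hs⟩ else x s with hy₀
      have hz : ∀ y, y ≠ y₀ → (entryMatrix (⟨ι, i, j⟩ : EntryIndex K d) x y : ℝ) = 0 := by
        intro y hy
        simp only [entryMatrix, Matrix.of_apply]
        rw [if_neg]
        · simp
        · rintro ⟨⟨-, h2⟩, h3⟩
          refine hy (funext fun s => ?_)
          by_cases hs : s ∈ K ι
          · simp [hy₀, hs, ← h2]
          · simp [hy₀, hs, h3 s (Finset.mem_compl.2 hs)]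
      rw [Finset.sum_eq_single y₀ (fun y _ hy => hz y hy) (by simp)]
      simp only [entryMatrix, Matrix.of_apply]
      by_cases hx : (fun s : K ι => x s) = i
      · simp only [hx, if_true]
        split_ifs <;> simp
      · simp [hx]
    have hsum : ∑ x, ∑ y, (entryMatrix (⟨ι, i, j⟩ : EntryIndex K d) x y : ℝ) ≤
        Fintype.card (Fin n → Fin d) / N := by
      refine (Finset.sum_le_sum fun x _ => hrow x).trans ?_
      rw [Finset.sum_boole, le_div_iff₀ hN0, hN]
      exact_mod_cast (card_restrict_eq_mul ι i).le
    calc (entryVar (⟨ι, i, j⟩ : EntryIndex K d) : ℝ) * _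
        ≤ 1 / N * (Fintype.card (Fin n → Fin d) / N) := by
          simp only [entryVar]
          push_cast
          gcongr
      _ = Fintype.card (Fin n → Fin d) / N ^ 2 := by field_simp
      _ ≤ _ := by gcongr
  row := by
    have : NeZero d := ⟨hd.ne'⟩
    ext1 x y
    rw [Matrix.sum_apply, Fintype.sum_sigma]
    -- Each `ι` contributes exactly one identity matrix: `N` columns `z` agree with `x` off `K ι`,
    -- and the variance is `1 / N`.
    have hι : ∀ ι, ∑ p, (entryVar (⟨ι, p⟩ : EntryIndex K d) • (entryMatrix ⟨ι, p⟩ *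
        (entryMatrix (⟨ι, p⟩ : EntryIndex K d)).transpose)) x y = if x = y then 1 else 0 := by
      intro ι
      have hN : (Fintype.card (K ι → Fin d) : ℝ≥0) ≠ 0 := by exact_mod_cast Fintype.card_ne_zero
      simp only [Matrix.smul_apply, Matrix.mul_apply, Matrix.transpose_apply, smul_eq_mul,
        show ∀ p, entryVar (⟨ι, p⟩ : EntryIndex K d) = 1 / (Fintype.card (K ι → Fin d) : ℝ≥0)
          from fun _ => rfl]
      rw [← Finset.mul_sum, Finset.sum_comm]
      split_ifs with hxy
      · subst hxy
        have hsq : ∀ (p : (K ι → Fin d) × (K ι → Fin d)) z,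
            entryMatrix (⟨ι, p⟩ : EntryIndex K d) x z * entryMatrix (⟨ι, p⟩ : EntryIndex K d) x z =
              1 * RingHom.id ℝ≥0 (entryMatrix (⟨ι, p⟩ : EntryIndex K d) x z) := by
          intro p z
          simp only [entryMatrix, Matrix.of_apply]
          split_ifs <;> simp
        simp only [hsq, sum_entryMatrix_apply (RingHom.id ℝ≥0) ι (fun _ => 1) x]
        rw [Finset.sum_boole, card_eq_off, one_div, inv_mul_cancel₀ hN]
      · rw [mul_eq_zero]
        refine .inr (Finset.sum_eq_zero fun z _ => Finset.sum_eq_zero fun p _ => ?_)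
        simp only [entryMatrix, Matrix.of_apply]
        by_contra h0
        rw [mul_ite, mul_one, mul_zero, ite_eq_right_iff, not_forall] at h0
        obtain ⟨⟨⟨h1, -⟩, h2⟩, h3⟩ := h0
        rw [ite_eq_right_iff, not_forall] at h3
        obtain ⟨⟨⟨h4, -⟩, h5⟩, -⟩ := h3
        refine hxy (funext fun s => ?_)
        by_cases hs : s ∈ K ι
        · exact congrFun (h4.trans h1.symm) ⟨s, hs⟩
        · have hs' := Finset.mem_compl.2 hs
          exact (h5 s hs').trans (h2 s hs').symm
    simp only [hι]
    by_cases hxy : x = y <;> simp [hxy]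

variable {Ω : Type*} [MeasurableSpace Ω] {P : Measure Ω} [IsProbabilityMeasure P]

theorem measurable_realCoord {N : Type*} {k : ℕ} (e : N ≃ Fin k)
    (c : {p : N × N // e p.2 ≤ e p.1} ⊕ {p : N × N // e p.2 < e p.1}) :
    Measurable fun A : N × N → ℂ => realCoord e (Matrix.of fun i j => A (i, j)) c := by
  rcases c with p | p
  · exact Complex.measurable_re.comp (measurable_pi_apply _)
  · exact Complex.measurable_im.comp (measurable_pi_apply _)

/-- Regrouping of the real coordinates of all the local matrices. -/
def coordEquiv {k : Fin m → ℕ} (e : ∀ ι, (K ι → Fin d) ≃ Fin (k ι)) :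
    ({c : EntryIndex K d // e c.1 c.2.2 ≤ e c.1 c.2.1} ⊕
      {c : EntryIndex K d // e c.1 c.2.2 < e c.1 c.2.1}) ≃
    Σ ι, {p : (K ι → Fin d) × (K ι → Fin d) // e ι p.2 ≤ e ι p.1} ⊕
      {p : (K ι → Fin d) × (K ι → Fin d) // e ι p.2 < e ι p.1} where
  toFun
    | .inl c => ⟨c.1.1, .inl ⟨c.1.2, c.2⟩⟩
    | .inr c => ⟨c.1.1, .inr ⟨c.1.2, c.2⟩⟩
  invFun
    | ⟨ι, .inl p⟩ => .inl ⟨⟨ι, p.1⟩, p.2⟩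
    | ⟨ι, .inr p⟩ => .inr ⟨⟨ι, p.1⟩, p.2⟩
  left_inv := by rintro (c | c) <;> rfl
  right_inv := by rintro ⟨ι, p | p⟩ <;> rfl

theorem exists_isWick_localGUE (hd : 0 < d)
    (G : ∀ ι : Fin m, Ω → Matrix (K ι → Fin d) (K ι → Fin d) ℂ)
    (hGUE : ∀ ι, IsGUE P (G ι))
    (hindep : iIndepFun (fun ι ω (p : (K ι → Fin d) × (K ι → Fin d)) => G ι ω p.1 p.2) P) :
    ∃ hZ : ∀ c : EntryIndex K d, HasMoments P fun ω => G c.1 ω c.2.1 c.2.2,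
      IsWick swapEntry entryVar (expectation P hZ) := by
  have : NeZero d := ⟨hd.ne'⟩
  choose e he using fun ι => (hGUE ι).indep
  have hfix : ∀ c : EntryIndex K d, swapEntry c = c ↔ c.2.1 = c.2.2 := by
    rintro ⟨ι, i, j⟩
    simp [swapEntry, eq_comm]
  have hlaw : ∀ k, HasLaw (fun ω => halfCoord (fun c : EntryIndex K d =>
      e c.1 c.2.2 ≤ e c.1 c.2.1) (fun c => e c.1 c.2.2 < e c.1 c.2.1)
      (fun c => G c.1 ω c.2.1 c.2.2) k) (gaussianReal 0 (halfVar swapEntry _ _ entryVar k)) P := by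
    rintro (⟨⟨ι, i, j⟩, hc⟩ | ⟨⟨ι, i, j⟩, hc⟩)
    · simp only [halfCoord, halfVar, hfix, entryVar]
      split_ifs with hij
      · subst hij
        exact (hGUE ι).diag_law i
      · rw [div_div, mul_comm]
        exact (hGUE ι).re_law i j hij
    · simp only [halfCoord, halfVar, entryVar]
      rw [div_div, mul_comm]
      exact (hGUE ι).im_law i j (by rintro rfl; exact lt_irrefl _ hc)
  refine exists_isWick_of_halfCoord (S := fun c : EntryIndex K d => e c.1 c.2.2 ≤ e c.1 c.2.1)
    (T := fun c => e c.1 c.2.2 < e c.1 c.2.1) swapEntry_involutive (fun c => le_total _ _)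
    (fun c h h' => (hfix c).2 ((e c.1).injective (le_antisymm h' h)))
    (fun c => ?_) (fun c => rfl) (fun c => ?_) ?_ hlaw ?_
  · rw [ne_eq, hfix, lt_iff_le_and_ne, ne_eq, (e c.1).apply_eq_iff_eq, eq_comm (a := c.2.2)]
  · simp only [entryVar, one_div, ne_eq, inv_eq_zero]
    exact_mod_cast Fintype.card_ne_zero
  · filter_upwards [ae_all_iff.2 fun ι => (hGUE ι).isHermitian] with ω hω c
    exact ((hω c.1).apply _ _).symm
  -- Joint moments factor in two stages, across the independent matrices and then within each one.
  -- Only this factorization is required, so joint independence of all the real coordinates need not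
  -- be assembled.
  · intro α
    set X : ∀ ι, ({p : (K ι → Fin d) × (K ι → Fin d) // e ι p.2 ≤ e ι p.1} ⊕
      {p : (K ι → Fin d) × (K ι → Fin d) // e ι p.2 < e ι p.1}) → Ω → ℝ :=
      fun ι c ω => realCoord (e ι) (G ι ω) c with hX
    set β : ∀ ι, ({p : (K ι → Fin d) × (K ι → Fin d) // e ι p.2 ≤ e ι p.1} ⊕
      {p : (K ι → Fin d) × (K ι → Fin d) // e ι p.2 < e ι p.1}) → ℕ :=
      fun ι c => α ((coordEquiv e).symm ⟨ι, c⟩) with hβ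
    have hXmeas : ∀ ι c, AEMeasurable (X ι c) P := by
      rintro ι (⟨⟨i, j⟩, h⟩ | ⟨⟨i, j⟩, h⟩)
      · exact (hlaw (.inl ⟨⟨ι, i, j⟩, h⟩)).aemeasurable
      · exact (hlaw (.inr ⟨⟨ι, i, j⟩, h⟩)).aemeasurable
    have hin : ∀ ι, ∫ ω, ∏ c, X ι c ω ^ β ι c ∂P = ∏ c, ∫ ω, X ι c ω ^ β ι c ∂P := by
      intro ι
      exact iIndepFun.integral_fun_prod_comp (X := X ι) (f := fun c x => x ^ β ι c) (he ι)
        (hXmeas ι) fun c => by fun_prop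
    have hout : ∫ ω, ∏ ι, ∏ c, X ι c ω ^ β ι c ∂P = ∏ ι, ∫ ω, ∏ c, X ι c ω ^ β ι c ∂P := by
      have h := hindep.comp (fun ι (A : (K ι → Fin d) × (K ι → Fin d) → ℂ) =>
        ∏ c, realCoord (e ι) (Matrix.of fun i j => A (i, j)) c ^ β ι c)
        fun ι => Finset.measurable_fun_prod _ fun c _ => (measurable_realCoord (e ι) c).pow_const _
      refine iIndepFun.integral_fun_prod_eq_prod_integral
        (X := fun ι ω => ∏ c, X ι c ω ^ β ι c) h fun ι => ?_
      exact (Finset.aemeasurable_fun_prod _ fun c _ =>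
        (hXmeas ι c).pow_const _).aestronglyMeasurable
    have hre : ∀ f : ∀ ι, ({p : (K ι → Fin d) × (K ι → Fin d) // e ι p.2 ≤ e ι p.1} ⊕
        {p : (K ι → Fin d) × (K ι → Fin d) // e ι p.2 < e ι p.1}) → ℝ,
        ∏ k, f (coordEquiv e k).1 (coordEquiv e k).2 = ∏ ι, ∏ c, f ι c := by
      intro f
      rw [← Fintype.prod_sigma']
      exact Fintype.prod_equiv (coordEquiv e) _ _ fun _ => rfl
    have hk : ∀ k ω, halfCoord (fun c : EntryIndex K d => e c.1 c.2.2 ≤ e c.1 c.2.1)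
        (fun c => e c.1 c.2.2 < e c.1 c.2.1) (fun c => G c.1 ω c.2.1 c.2.2) k ^ α k =
        X (coordEquiv e k).1 (coordEquiv e k).2 ω ^
          β (coordEquiv e k).1 (coordEquiv e k).2 := by
      intro k ω
      rw [hβ]
      simp only [Sigma.eta, Equiv.symm_apply_apply]
      rcases k with k | k <;> rfl
    simp only [hk]
    rw [hre (fun ι c => ∫ ω, X ι c ω ^ β ι c ∂P)]
    have hre' : ∀ ω, ∏ k, X (coordEquiv e k).1 (coordEquiv e k).2 ω ^
        β (coordEquiv e k).1 (coordEquiv e k).2 = ∏ ι, ∏ c, X ι c ω ^ β ι c :=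
      fun ω => hre fun ι c => X ι c ω ^ β ι c
    simp only [hre', hout, hin]

theorem measure_hamiltonian_trace_pow_lt_le (hd : 0 < d) (hK : ∀ ι, (K ι).Nonempty)
    (G : ∀ ι : Fin m, Ω → Matrix (K ι → Fin d) (K ι → Fin d) ℂ)
    (hGUE : ∀ ι, IsGUE P (G ι))
    (hindep : iIndepFun (fun ι ω (p : (K ι → Fin d) × (K ι → Fin d)) => G ι ω p.1 p.2) P)
    (p : ℕ) {η : ℝ} (hη : 0 < η) :
    P {ω | (hamiltonian K (fun ι => G ι ω) ^ (p + 1)).trace.re / Fintype.card (Fin n → Fin d) <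
        semicircleMoment m (p + 1) - η} ≤
      ENNReal.ofReal ((p + 1) ^ 2 * m * momentBound m p / η ^ 2 * (1 / (d : ℝ) ^ 2)) := by
  have : NeZero d := ⟨hd.ne'⟩
  obtain ⟨hZ, hW⟩ := exists_isWick_localGUE hd G hGUE hindep
  have hconj : ∀ᵐ ω ∂P, ∀ c : EntryIndex K d,
      G (swapEntry c).1 ω (swapEntry c).2.1 (swapEntry c).2.2 =
        starRingEnd ℂ (G c.1 ω c.2.1 c.2.2) := by
    filter_upwards [ae_all_iff.2 fun ι => (hGUE ι).isHermitian] with ω hω c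
    exact ((hω c.1).apply _ _).symm
  simp only [hamiltonian_eq_linearMatrix]
  exact (isModel_entryMatrix hd hK).measure_trace_pow_lt_le hW hconj p hη le_rfl

theorem ae_eventually_semicircleMoment_le (hK : ∀ ι, (K ι).Nonempty)
    (G : ∀ (d : ℕ) (ι : Fin m), Ω → Matrix (K ι → Fin d) (K ι → Fin d) ℂ)
    (hGUE : ∀ d ι, IsGUE P (G d ι))
    (hindep : ∀ d, iIndepFun (fun ι ω (p : (K ι → Fin d) × (K ι → Fin d)) =>
      G d ι ω p.1 p.2) P) (j : ℕ) {η : ℝ} (hη : 0 < η) :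
    ∀ᵐ ω ∂P, ∀ᶠ d : ℕ in atTop, semicircleMoment m j - η ≤
      (hamiltonian K (fun ι => G d ι ω) ^ j).trace.re / Fintype.card (Fin n → Fin d) := by
  rcases j with _ | p
  · refine Eventually.of_forall fun ω => ?_
    filter_upwards [eventually_gt_atTop 0] with d hd
    have : NeZero d := ⟨hd.ne'⟩
    have hc : (Fintype.card (Fin n → Fin d) : ℝ) ≠ 0 := by exact_mod_cast Fintype.card_ne_zero
    rw [pow_zero, Matrix.trace_one, Complex.natCast_re, div_self hc]
    simp [semicircleMoment, hη.le]
  -- The dimension is shifted to `d + 1` because the tail bound needs it positive. Summability alone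
  -- drives the first Borel–Cantelli lemma, without independence across dimensions.
  have hsum : Summable fun d : ℕ =>
      (p + 1 : ℝ) ^ 2 * m * momentBound m p / η ^ 2 * (1 / ((d + 1 : ℕ) : ℝ) ^ 2) :=
    ((summable_nat_add_iff 1).2 (Real.summable_one_div_nat_pow.2 one_lt_two)).mul_left _
  have hae := ae_eventually_notMem (μ := P) (s := fun d : ℕ =>
    {ω | (hamiltonian K (fun ι => G (d + 1) ι ω) ^ (p + 1)).trace.re /
      Fintype.card (Fin n → Fin (d + 1)) < semicircleMoment m (p + 1) - η}) <|
    ne_top_of_le_ne_top hsum.tsum_ofReal_ne_top <| ENNReal.tsum_le_tsum fun d =>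
      measure_hamiltonian_trace_pow_lt_le d.succ_pos hK (G (d + 1)) (hGUE _) (hindep _) p hη
  filter_upwards [hae] with ω hω
  obtain ⟨N, hN⟩ := eventually_atTop.1 hω
  refine eventually_atTop.2 ⟨N + 1, fun d hd => ?_⟩
  obtain ⟨d, rfl⟩ : ∃ k, d = k + 1 := ⟨d - 1, by omega⟩
  exact not_lt.1 (hN d (by omega))

end Local

end LocalGUE

theorem mainTheorem7 {Ω : Type*} [MeasurableSpace Ω] (P : Measure Ω) [IsProbabilityMeasure P]
    (n m : ℕ) (K : Fin m → Finset (Fin n)) (hK : ∀ ι, (K ι).Nonempty)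
    (G : ∀ (d : ℕ) (ι : Fin m), Ω → Matrix (K ι → Fin d) (K ι → Fin d) ℂ)
    (hGUE : ∀ d ι, LocalGUE.IsGUE P (G d ι))
    (hindep : ∀ d, iIndepFun (fun ι ω (p : (K ι → Fin d) × (K ι → Fin d)) => G d ι ω p.1 p.2) P) :
    ∀ᵐ ω ∂P, ∀ δ : ℝ, 0 < δ → ∀ᶠ d : ℕ in atTop,
      2 * Real.sqrt m - δ ≤ LocalGUE.lambdaMax (LocalGUE.hamiltonian K (fun ι => G d ι ω)) := by
  -- Tolerances `1 / (k + 1)` keep the intersection of almost sure events countable, so that `δ`,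
  -- and the `η` depending on it, can be chosen after `ω`.
  have hmom : ∀ᵐ ω ∂P, ∀ j k : ℕ, ∀ᶠ d : ℕ in atTop,
      LocalGUE.semicircleMoment m j - 1 / ((k : ℝ) + 1) ≤
        (LocalGUE.hamiltonian K (fun ι => G d ι ω) ^ j).trace.re /
          Fintype.card (Fin n → Fin d) :=
    ae_all_iff.2 fun j => ae_all_iff.2 fun k =>
      LocalGUE.ae_eventually_semicircleMoment_le hK G hGUE hindep j Nat.one_div_pos_of_nat
  have hherm : ∀ᵐ ω ∂P, ∀ d ι, (G d ι ω).IsHermitian :=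
    ae_all_iff.2 fun d => ae_all_iff.2 fun ι => (hGUE d ι).isHermitian
  filter_upwards [hmom, hherm] with ω hω hH δ hδ
  obtain ⟨L, η, hη, hL⟩ := LocalGUE.exists_moments_imp_le_lambdaMax m hδ
  obtain ⟨k, hk⟩ := exists_nat_one_div_lt hη
  have hall : ∀ᶠ d : ℕ in atTop, ∀ j ∈ Finset.range (L + 1),
      LocalGUE.semicircleMoment m j - 1 / ((k : ℝ) + 1) ≤
        (LocalGUE.hamiltonian K (fun ι => G d ι ω) ^ j).trace.re /
          Fintype.card (Fin n → Fin d) :=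
    (Finset.eventually_all _).2 fun j _ => hω j k
  filter_upwards [hall, eventually_gt_atTop 0] with d hd hd0
  have : NeZero d := ⟨hd0.ne'⟩
  refine hL (Fin n → Fin d) _ ?_ fun j hj => ?_
  · rw [LocalGUE.hamiltonian_eq_linearMatrix]
    exact (LocalGUE.isModel_entryMatrix hd0 hK).isHermitian fun c =>
      ((hH d c.1).apply _ _).symm
  · have := hd j (Finset.mem_range.2 (Nat.lt_succ_of_le hj))
    linarith
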